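/- Let $n\ge 1$ and let $g_1,\dots,g_n$ be transcendental entire functions with $g_i\circ g_j=g_j\circ g_i$ for all $i,j$. Let $G=[g_1,\dots,g_n]$ be the semigroup generated by them under composition. A family of entire functions is normal on a domain if every sequence in it has a subsequence converging locally uniformly there either to a holomorphic function or to $\infty$. Let $F(G)\subset\mathbb C$ be the set of points having a neighbourhood on which $G$ is normal, and let $J(G)=\mathbb C\setminus F(G)$. For each $i$, let $F(g_i)$ be the set of points having a neighbourhood on which the family of iterates $\{g_i^m : m\ge 1\}$ is normal. Suppose that for every $i$ every connected component of $F(g_i)$ is bounded, and that for every connected component $U$ of $F(G)$ no sequence of elements of $G$ has a subsequence converging to $\infty$ locally uniformly on $U$. Then every connected component of $F(G)$ is simply connected, and $J(G)$ is a connected subset of $\mathbb C$. -/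

import Mathlib

open Set Filter Topology

namespace TranscendentalSemigroup

/-- A transcendental entire function: entire and not a polynomial. -/
def IsTranscendentalEntire (f : ℂ → ℂ) : Prop :=
  Differentiable ℂ f ∧ ∀ p : Polynomial ℂ, f ≠ fun z => p.eval z

/-- The sequence `s` converges to the constant `∞` locally uniformly on `U`. -/
def TendstoInftyLocallyUniformlyOn (s : ℕ → ℂ → ℂ) (U : Set ℂ) : Prop :=
  ∀ M : ℝ, ∀ z ∈ U, ∃ t ∈ 𝓝[U] z, ∀ᶠ k in atTop, ∀ w ∈ t, M < ‖s k w‖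

/-- The constant `∞` is a limit function of the sequence `s` on `U`: some subsequence of `s`
converges to `∞` locally uniformly on `U`. -/
def InftyIsLimitFunction (s : ℕ → ℂ → ℂ) (U : Set ℂ) : Prop :=
  ∃ φ : ℕ → ℕ, StrictMono φ ∧ TendstoInftyLocallyUniformlyOn (fun k => s (φ k)) U

/-- Normality (in the sense of Montel) of a family of entire functions on a domain `U`: every
sequence in the family has a subsequence that converges locally uniformly on `U`, either to a
finite (then automatically holomorphic) function or to `∞`. -/
def IsNormalOn (𝓕 : Set (ℂ → ℂ)) (U : Set ℂ) : Prop :=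
  ∀ s : ℕ → ℂ → ℂ, (∀ k, s k ∈ 𝓕) →
    (∃ φ : ℕ → ℕ, StrictMono φ ∧
      ∃ h : ℂ → ℂ, TendstoLocallyUniformlyOn (fun k => s (φ k)) h atTop U) ∨
    InftyIsLimitFunction s U

/-- The set of normality of a family of entire functions: the points that have a connected open
neighbourhood on which the family is normal. As normality is a local property, this is the largest
open set on which the family is normal. -/
def normalitySet (𝓕 : Set (ℂ → ℂ)) : Set ℂ :=
  {z | ∃ U : Set ℂ, IsOpen U ∧ IsConnected U ∧ z ∈ U ∧ IsNormalOn 𝓕 U}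

theorem isOpen_normalitySet (𝓕 : Set (ℂ → ℂ)) : IsOpen (normalitySet 𝓕) := by
  rw [isOpen_iff_mem_nhds]
  rintro z ⟨U, hU, hc, hz, hn⟩
  exact mem_of_superset (hU.mem_nhds hz) fun w hw => ⟨U, hU, hc, hw, hn⟩

/-- The Fatou set `F(f)` of a single function, through its iterates `f, f ∘ f, …`. -/
def fatouSet (f : ℂ → ℂ) : Set ℂ :=
  normalitySet {h | ∃ m : ℕ, 1 ≤ m ∧ h = f^[m]}

/-- The semigroup `[g₁, …, gₙ]` generated by `g₁, …, gₙ` under composition (which is the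
multiplication of `Function.End ℂ`). -/
def generatedSemigroup {n : ℕ} (g : Fin n → ℂ → ℂ) : Subsemigroup (Function.End ℂ) :=
  Subsemigroup.closure (Set.range fun i => (g i : Function.End ℂ))

/-- The Fatou set `F(G)` of a semigroup `G` of entire functions. -/
def semigroupFatouSet (G : Subsemigroup (Function.End ℂ)) : Set ℂ :=
  normalitySet {h : ℂ → ℂ | (h : Function.End ℂ) ∈ G}

/-- The Julia set `J(G)` of `G` in the plane, the complement of `F(G)`. -/
def semigroupJuliaSet (G : Subsemigroup (Function.End ℂ)) : Set ℂ :=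
  (semigroupFatouSet G)ᶜ

/-- `U` is a connected component of the plane set `S`. -/
def IsComponentOf (U S : Set ℂ) : Prop :=
  ∃ z ∈ S, U = connectedComponentIn S z

end TranscendentalSemigroup

/-!
Write `F` for the set of normality of the semigroup `G`. The semigroup contains the iterates of each
generator, so that `F` lies in the Fatou set of a generator and has bounded components.

*The complement of a component `U` of `F` is connected.* As `∞` is not a limit function on `U`, the
family `G` is locally bounded on `U` (`exists_ball_bounded`): if a sequence tends to `∞` near one
point of `U`, then normality spreads this to all of `U`. If the complement of `U` had a compact part
separated from the rest, then `G` would be bounded on a compact set in `U` around this part, hence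
near the part itself by the maximum principle, and the part would lie in `F` by Montel's theorem.
The component of `F` that contains one of its points would then be open and closed in the plane
(`not_compl_component_eq_union`).

*A bounded plane domain `U` with connected complement is simply connected*
(`isSimplyConnected_of_isPreconnected_compl`). A loop in `U` is homotopic to a closed walk in a
fine square grid. The winding number of such a walk is constant on the complement of `U`, so it
vanishes about every square that is not contained in `U`. The squares in `U` can be removed one by
one from the top, together with their upper edges, without changing the homotopy classes of walks.
What remains is a graph in which all closed walks have winding number zero everywhere; it has no
cycles, so that its closed walks are trivial (`GridWalk.walkHom_eq_id`).

*The complement of `F` is connected* (`isConnected_compl_of_components`). By the unicoherence of the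
plane, a component `U` has connected boundary. If the complement of `F` were separated, then each
component could be added to the side that contains its boundary, which would separate the plane.
-/

/-! ### Walks in the square grid -/

namespace GridWalk

open CategoryTheory SimpleGraph

section Labels

variable {V : Type*} {C : Type*} [Groupoid C] {G : SimpleGraph V}

/-- The composite of the morphisms `h u v` along the edges of a walk. -/
def walkHom {x : V → C} (h : ∀ u v, x u ⟶ x v) : ∀ {u v : V}, G.Walk u v → (x u ⟶ x v)
  | u, _, .nil => 𝟙 (x u)
  | _, _, .cons (u := u) (v := v) _ p => h u v ≫ walkHom h p

/-- The sum of the integers `c u v` over the edges of a walk. -/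
def walkSum (c : V → V → ℤ) : ∀ {u v : V}, G.Walk u v → ℤ
  | _, _, .nil => 0
  | _, _, .cons (u := u) (v := v) _ p => c u v + walkSum c p

variable {x : V → C} {h : ∀ u v, x u ⟶ x v} {c d : V → V → ℤ}

theorem walkHom_append {u v w : V} (p : G.Walk u v) (q : G.Walk v w) :
    walkHom h (p.append q) = walkHom h p ≫ walkHom h q := by
  induction p with
  | nil => simp [walkHom]
  | cons a p ih => simp [walkHom, ih]

theorem walkSum_mapLe {G' : SimpleGraph V} (hle : G ≤ G') {u v : V} (p : G.Walk u v) :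
    walkSum c (p.mapLe hle) = walkSum c p := by
  induction p with
  | nil => rfl
  | cons a p ih =>
    simp only [Walk.mapLe, Walk.map_cons, walkSum] at ih ⊢
    rw [ih]
    rfl

theorem walkSum_eq_zero {u v : V} (p : G.Walk u v)
    (hc : ∀ a b, s(a, b) ∈ p.edges → c a b = 0) : walkSum c p = 0 := by
  induction p with
  | nil => rfl
  | cons a p ih =>
    rw [walkSum, hc _ _ (by simp), ih fun a b hab => hc a b (by simp [hab]), add_zero]

/-- Two labellings that differ by a coboundary on the edges of a closed walk have the same sum. -/
theorem walkSum_sub_eq (φ : V → ℤ) {u v : V} (p : G.Walk u v)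
    (hc : ∀ a b, G.Adj a b → s(a, b) ∈ p.edges → c a b - d a b = φ b - φ a) :
    walkSum c p - walkSum d p = φ v - φ u := by
  induction p with
  | nil => simp [walkSum]
  | cons a p ih =>
    have h1 := ih fun a b hG hab => hc a b hG (by simp [hab])
    have h2 := hc _ _ a (by simp)
    simp only [walkSum]
    linarith

/-- If every closed walk that consists of an edge followed by a path has trivial composite, then
erasing loops does not change the composite of a walk. -/
theorem walkHom_bypass [DecidableEq V]
    (hcyc : ∀ (u v : V) (a : G.Adj u v) (p : G.Walk v u), p.IsPath →
      walkHom h (Walk.cons a p) = 𝟙 (x u)) {u v : V} (p : G.Walk u v) :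
    walkHom h p.bypass = walkHom h p := by
  induction p with
  | nil => rfl
  | @cons u w v a p ih =>
    simp only [Walk.bypass]
    split_ifs with hs
    · have h1 := hcyc _ _ a _ (p.bypass_isPath.takeUntil hs)
      have h2 : walkHom h p.bypass =
          walkHom h (p.bypass.takeUntil _ hs) ≫ walkHom h (p.bypass.dropUntil _ hs) := by
        rw [← walkHom_append, p.bypass.take_spec hs]
      rw [walkHom] at h1
      rw [walkHom, ← ih, h2, ← Category.assoc, h1, Category.id_comp]
    · rw [walkHom, walkHom, ih]

theorem walkHom_eq_id_of_isAcyclic (hG : G.IsAcyclic)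
    (hinv : ∀ u v, G.Adj u v → h u v ≫ h v u = 𝟙 (x u)) {u : V} (p : G.Walk u u) :
    walkHom h p = 𝟙 (x u) := by
  classical
  rw [← walkHom_bypass _ p]
  · rw [(Walk.isPath_iff_nil.1 p.bypass_isPath).eq_nil, walkHom]
  · intro u v a p hp
    have hmem : s(u, v) ∈ p.edges := by
      by_contra hn
      exact hG _ ((Walk.cons_isCycle_iff p a).2 ⟨hp, hn⟩)
    cases p with
    | nil => exact absurd a (G.irrefl)
    | @cons _ w _ b q =>
      rw [Walk.cons_isPath_iff] at hp
      rw [Walk.edges_cons, List.mem_cons] at hmem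
      rcases hmem with hmem | hmem
      · have hw : w = u := by
          rw [Sym2.eq_iff] at hmem
          rcases hmem with ⟨h1, h2⟩ | ⟨h1, h2⟩
          · exact absurd h1 a.ne
          · exact h1.symm
        subst hw
        rw [(Walk.isPath_iff_nil.1 hp.1).eq_nil, walkHom, walkHom, walkHom, Category.comp_id,
          hinv _ _ a]
      · exact absurd (q.snd_mem_support_of_mem_edges hmem) hp.2

end Labels

/-- The signed number of times that the step from `u` to `v` traverses the edge from `p`
to `q`. -/
def edgeSign {V : Type*} [DecidableEq V] (p q u v : V) : ℤ :=
  (if u = p ∧ v = q then 1 else 0) - (if u = q ∧ v = p then 1 else 0)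

theorem edgeSign_eq_zero {V : Type*} [DecidableEq V] {p q u v : V} (h : s(u, v) ≠ s(p, q)) :
    edgeSign p q u v = 0 := by
  rw [Ne, Sym2.eq_iff] at h
  grind [edgeSign]

/-- The graph `ℤ × ℤ` in which every point is joined to its four neighbours. -/
def squareGrid : SimpleGraph (ℤ × ℤ) where
  Adj u v := (u.2 = v.2 ∧ (v.1 = u.1 + 1 ∨ u.1 = v.1 + 1)) ∨
    (u.1 = v.1 ∧ (v.2 = u.2 + 1 ∨ u.2 = v.2 + 1))
  symm := ⟨by intro u v; grind⟩
  loopless := ⟨by intro u; grind⟩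

/-- The signed number of times that the step from `u` to `v` crosses the horizontal ray that goes
to the right from the centre of the unit square with lower left corner `S`. Summed over a closed
walk, it is the winding number about that square. -/
def crossing (S u v : ℤ × ℤ) : ℤ :=
  if S.1 < u.1 then (if S.2 < v.2 then 1 else 0) - (if S.2 < u.2 then 1 else 0) else 0

/-- The crossing numbers of two squares, one above the other, differ by the traversals of their
common edge, up to the coboundary of the indicator of the half-line to the right of it. -/
theorem crossing_sub_crossing_up {i j : ℤ} {u v : ℤ × ℤ} (h : squareGrid.Adj u v) :
    crossing (i, j) u v - crossing (i, j + 1) u v + edgeSign (i, j + 1) (i + 1, j + 1) u v =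
      (if v.2 = j + 1 ∧ i < v.1 then 1 else 0) - (if u.2 = j + 1 ∧ i < u.1 then 1 else 0) := by
  obtain ⟨a, b⟩ := u
  obtain ⟨a', b'⟩ := v
  simp only [squareGrid, crossing, edgeSign, Prod.mk.injEq] at h ⊢
  split_ifs <;> omega

theorem crossing_sub_crossing_right {i j : ℤ} {u v : ℤ × ℤ} (h : squareGrid.Adj u v) :
    crossing (i, j) u v - crossing (i + 1, j) u v = edgeSign (i + 1, j) (i + 1, j + 1) u v := by
  obtain ⟨a, b⟩ := u
  obtain ⟨a', b'⟩ := v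
  simp only [squareGrid, crossing, edgeSign, Prod.mk.injEq] at h ⊢
  split_ifs <;> omega

variable {E : SimpleGraph (ℤ × ℤ)}

theorem walkSum_add {V : Type*} {G : SimpleGraph V} (c d : V → V → ℤ) {u v : V}
    (p : G.Walk u v) :
    walkSum (fun a b => c a b + d a b) p = walkSum c p + walkSum d p := by
  induction p with
  | nil => rfl
  | cons a p ih => simp only [walkSum, ih]; ring

theorem walkSum_crossing_up (hE : E ≤ squareGrid) (i j : ℤ) {u : ℤ × ℤ} (p : E.Walk u u) :
    walkSum (crossing (i, j)) p + walkSum (edgeSign (i, j + 1) (i + 1, j + 1)) p =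
      walkSum (crossing (i, j + 1)) p := by
  have := walkSum_sub_eq (c := fun a b => crossing (i, j) a b +
    edgeSign (i, j + 1) (i + 1, j + 1) a b) (d := crossing (i, j + 1))
    (fun v => if v.2 = j + 1 ∧ i < v.1 then 1 else 0) p fun a b hab _ => by
      rw [← crossing_sub_crossing_up (hE hab)]; ring
  rw [walkSum_add] at this
  linarith

theorem walkSum_crossing_right (hE : E ≤ squareGrid) (i j : ℤ) {u : ℤ × ℤ} (p : E.Walk u u) :
    walkSum (crossing (i + 1, j)) p + walkSum (edgeSign (i + 1, j) (i + 1, j + 1)) p =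
      walkSum (crossing (i, j)) p := by
  have := walkSum_sub_eq (c := fun a b => crossing (i + 1, j) a b +
    edgeSign (i + 1, j) (i + 1, j + 1) a b) (d := crossing (i, j))
    (fun _ => 0) p fun a b hab _ => by
      rw [← crossing_sub_crossing_right (hE hab)]; ring
  rw [walkSum_add] at this
  linarith

theorem walkSum_edgeSign_of_not_adj {p q : ℤ × ℤ} (h : ¬ E.Adj p q) {u v : ℤ × ℤ}
    (w : E.Walk u v) : walkSum (edgeSign p q) w = 0 := by
  refine walkSum_eq_zero w fun a b hab => edgeSign_eq_zero fun he => h ?_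
  have := w.edges_subset_edgeSet hab
  rwa [he] at this

/-- The winding numbers about the two squares above and below an edge that is missing from the
graph agree. -/
theorem walkSum_crossing_up_eq (hE : E ≤ squareGrid) {i j : ℤ}
    (h : ¬ E.Adj (i, j + 1) (i + 1, j + 1)) {u : ℤ × ℤ} (p : E.Walk u u) :
    walkSum (crossing (i, j)) p = walkSum (crossing (i, j + 1)) p := by
  rw [← walkSum_crossing_up hE, walkSum_edgeSign_of_not_adj h, add_zero]

/-- The winding numbers about the two squares beside an edge that is missing from the graph
agree. -/
theorem walkSum_crossing_right_eq (hE : E ≤ squareGrid) {i j : ℤ}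
    (h : ¬ E.Adj (i + 1, j) (i + 1, j + 1)) {u : ℤ × ℤ} (p : E.Walk u u) :
    walkSum (crossing (i, j)) p = walkSum (crossing (i + 1, j)) p := by
  rw [← walkSum_crossing_right hE, walkSum_edgeSign_of_not_adj h, add_zero]

theorem walkSum_crossing_eq_zero_of_le {i j : ℤ} {u v : ℤ × ℤ} (p : E.Walk u v)
    (h : ∀ w ∈ p.support, w.1 ≤ i) : walkSum (crossing (i, j)) p = 0 := by
  refine walkSum_eq_zero p fun a b hab => ?_
  have := h a (p.fst_mem_support_of_mem_edges hab)
  simp [crossing, this]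

/-- A subgraph of the grid in which all winding numbers of closed walks vanish has no cycles: a
cycle traverses each of its edges once, and the winding number jumps there. -/
theorem isAcyclic_of_walkSum_eq_zero (hE : E ≤ squareGrid)
    (hw : ∀ S u (p : E.Walk u u), walkSum (crossing S) p = 0) : E.IsAcyclic := by
  have key : ∀ a b, E.Adj a b → ∀ u (p : E.Walk u u), walkSum (edgeSign a b) p = 0 := by
    have hneg : ∀ a b u v (p : E.Walk u v),
        walkSum (edgeSign a b) p + walkSum (edgeSign b a) p = 0 := by
      intro a b u v p
      rw [← walkSum_add]
      exact walkSum_eq_zero p fun _ _ _ => by simp only [edgeSign]; ring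
    have hup : ∀ i j u (p : E.Walk u u), walkSum (edgeSign (i, j) (i + 1, j)) p = 0 := by
      intro i j u p
      have := walkSum_crossing_up hE i (j - 1) p
      rw [hw, hw] at this
      simpa using this
    have hright : ∀ i j u (p : E.Walk u u), walkSum (edgeSign (i, j) (i, j + 1)) p = 0 := by
      intro i j u p
      have := walkSum_crossing_right hE (i - 1) j p
      rw [hw, hw] at this
      simpa using this
    rintro ⟨i, j⟩ ⟨i', j'⟩ hab u p
    have hn := hneg (i, j) (i', j') u u p
    rcases hE hab with ⟨h1, h2 | h2⟩ | ⟨h1, h2 | h2⟩ <;> simp only at h1 h2 <;> subst h1 h2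
    · exact hup _ _ _ p
    · rw [hup] at hn
      linarith
    · exact hright _ _ _ p
    · rw [hright] at hn
      linarith
  intro u p hp
  cases p with
  | nil => exact Walk.not_isCycle_nil hp
  | @cons _ v _ a q =>
    rw [Walk.cons_isCycle_iff] at hp
    have h0 := key _ _ a _ (Walk.cons a q)
    rw [walkSum, walkSum_eq_zero q] at h0
    · simp [edgeSign, a.ne] at h0
    · intro c d hcd
      exact edgeSign_eq_zero fun he => hp.2 (he ▸ hcd)

/-- Let `h` be a labelling of the edges of `E` by morphisms of a groupoid that is trivial around
the unit squares in `T`, and suppose that the closed walks of `E` have winding number zero about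
all the other squares. Then the labelling is trivial around all closed walks. The highest square
of `T` is removed together with its upper edge, which can be replaced by the other three. -/
theorem walkHom_eq_id {C : Type*} [Groupoid C] {x : ℤ × ℤ → C} {h : ∀ u v, x u ⟶ x v}
    (T : Finset (ℤ × ℤ)) (hE : E ≤ squareGrid)
    (hinv : ∀ u v, E.Adj u v → h u v ≫ h v u = 𝟙 (x u))
    (hT : ∀ i j : ℤ, (i, j) ∈ T → E.Adj (i, j) (i + 1, j) ∧ E.Adj (i + 1, j) (i + 1, j + 1) ∧
      E.Adj (i, j) (i, j + 1) ∧
      h (i, j + 1) (i, j) ≫ h (i, j) (i + 1, j) ≫ h (i + 1, j) (i + 1, j + 1) =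
        h (i, j + 1) (i + 1, j + 1))
    (hw : ∀ S, S ∉ T → ∀ u (p : E.Walk u u), walkSum (crossing S) p = 0)
    {u : ℤ × ℤ} (p : E.Walk u u) : walkHom h p = 𝟙 (x u) := by
  induction hn : T.card generalizing T E with
  | zero =>
    rw [Finset.card_eq_zero] at hn
    subst hn
    exact walkHom_eq_id_of_isAcyclic
      (isAcyclic_of_walkSum_eq_zero hE fun S => hw S (by simp)) hinv p
  | succ n ih =>
    obtain ⟨⟨i, j⟩, hS, hmax⟩ := T.exists_max_image Prod.snd (Finset.card_pos.1 (by omega))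
    obtain ⟨h1, h2, h3, h4⟩ := hT i j hS
    set E' := E.deleteEdges {s((i, j + 1), (i + 1, j + 1))} with hE'
    have hle : E' ≤ E := E.deleteEdges_le _
    have hadj : ∀ a b, E'.Adj a b ↔ E.Adj a b ∧ s(a, b) ≠ s((i, j + 1), (i + 1, j + 1)) := by
      intro a b
      simp only [hE', deleteEdges_adj, mem_singleton_iff, ne_eq]
    have h1' : E'.Adj (i, j) (i + 1, j) := (hadj _ _).2 ⟨h1, by simp⟩
    have h2' : E'.Adj (i + 1, j) (i + 1, j + 1) := (hadj _ _).2 ⟨h2, by simp⟩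
    have h3' : E'.Adj (i, j) (i, j + 1) := (hadj _ _).2 ⟨h3, by simp⟩
    have hrep : ∀ {a b} (q : E.Walk a b), ∃ q' : E'.Walk a b, walkHom h q' = walkHom h q := by
      intro a b q
      induction q with
      | nil => exact ⟨.nil, rfl⟩
      | @cons a c b e q ihq =>
        obtain ⟨q', hq'⟩ := ihq
        by_cases hes : s(a, c) = s((i, j + 1), (i + 1, j + 1))
        · rw [Sym2.eq_iff] at hes
          rcases hes with ⟨rfl, rfl⟩ | ⟨rfl, rfl⟩
          · refine ⟨.cons h3'.symm (.cons h1' (.cons h2' q')), ?_⟩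
            simp only [walkHom, hq', ← h4, Category.assoc]
          · refine ⟨.cons h2'.symm (.cons h1'.symm (.cons h3' q')), ?_⟩
            simp only [walkHom, hq']
            -- The reversed edge is the inverse of the reversed detour.
            have e1 := hinv _ _ e
            have e2 := hinv _ _ h2.symm
            have e3 := hinv _ _ h1.symm
            have e4 := hinv _ _ h3
            have : h (i + 1, j + 1) (i, j + 1) =
                h (i + 1, j + 1) (i + 1, j) ≫ h (i + 1, j) (i, j) ≫ h (i, j) (i, j + 1) := by
              rw [← cancel_mono (h (i, j + 1) (i + 1, j + 1)), e1, ← h4]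
              simp only [Category.assoc]
              rw [reassoc_of% e4, reassoc_of% e3, e2]
            rw [this]
            simp only [Category.assoc]
        · exact ⟨.cons ((hadj _ _).2 ⟨e, hes⟩) q', by simp only [walkHom, hq']⟩
    obtain ⟨p', hp'⟩ := hrep p
    rw [← hp']
    refine ih (T.erase (i, j)) (hle.trans hE) (fun u v huv => hinv u v (hle huv)) ?_ ?_ p' ?_
    · intro k l hkl
      rw [Finset.mem_erase] at hkl
      obtain ⟨g1, g2, g3, g4⟩ := hT k l hkl.2
      have hl := hmax _ hkl.2
      simp only at hl
      have hne := hkl.1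
      simp only [ne_eq, Prod.mk.injEq, not_and] at hne
      refine ⟨(hadj _ _).2 ⟨g1, ?_⟩, (hadj _ _).2 ⟨g2, ?_⟩, (hadj _ _).2 ⟨g3, ?_⟩, g4⟩
      all_goals simp only [ne_eq, Sym2.eq_iff, Prod.mk.injEq]; omega
    · intro S hS' u q
      by_cases hSS : S = (i, j)
      · subst hSS
        rw [walkSum_crossing_up_eq (hle.trans hE) (fun hc => ((hadj _ _).1 hc).2 rfl),
          ← walkSum_mapLe hle]
        refine hw _ (fun hc => ?_) _ _
        have := hmax _ hc
        simp only at this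
        omega
      · rw [← walkSum_mapLe hle]
        exact hw _ (fun hc => hS' (Finset.mem_erase.2 ⟨hSS, hc⟩)) _ _
    · rw [Finset.card_erase_of_mem hS, hn]
      rfl

end GridWalk

/-! ### Plane domains with connected complement are simply connected -/

namespace PlaneDomain

open CategoryTheory SimpleGraph GridWalk unitInterval

variable {U : Set ℂ}

/-- Paths in `U` with common end points that stay in a convex subset of `U` are homotopic
in `U`. -/
theorem homotopic_of_convex {D : Set ℂ} (hD : Convex ℝ D) (hDU : D ⊆ U) {a b : U}
    (p q : Path a b) (hp : ∀ t, (p t : ℂ) ∈ D) (hq : ∀ t, (q t : ℂ) ∈ D) : p.Homotopic q := by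
  refine ⟨⟨⟨⟨fun s => ⟨AffineMap.lineMap (p s.2 : ℂ) (q s.2 : ℂ) (s.1 : ℝ),
    hDU (hD.lineMap_mem (hp _) (hq _) s.1.2)⟩, ?_⟩, ?_, ?_⟩, ?_⟩⟩
  · refine Continuous.subtype_mk ?_ _
    simp only [AffineMap.lineMap_apply_module]
    fun_prop
  · intro t
    simp
  · intro t
    simp
  · rintro t s (rfl | rfl) <;> simp

theorem exists_path_mem_convex {D : Set ℂ} (hD : Convex ℝ D) (hDU : D ⊆ U) (a b : U)
    (ha : (a : ℂ) ∈ D) (hb : (b : ℂ) ∈ D) : ∃ p : Path a b, ∀ t, (p t : ℂ) ∈ D := by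
  refine ⟨⟨⟨fun t => ⟨AffineMap.lineMap (a : ℂ) (b : ℂ) (t : ℝ),
    hDU (hD.lineMap_mem ha hb t.2)⟩, ?_⟩, ?_, ?_⟩, fun t => hD.lineMap_mem ha hb t.2⟩
  · refine Continuous.subtype_mk ?_ _
    simp only [AffineMap.lineMap_apply_module]
    fun_prop
  · simp
  · simp

/-- The point of the grid of mesh `δ` with integer coordinates `v`. -/
def gridPoint (δ : ℝ) (v : ℤ × ℤ) : ℂ := ⟨δ * v.1, δ * v.2⟩

/-- The closed square of the grid of mesh `δ` with lower left corner `S`. -/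
def gridSquare (δ : ℝ) (S : ℤ × ℤ) : Set ℂ :=
  Icc (δ * S.1) (δ * (S.1 + 1)) ×ℂ Icc (δ * S.2) (δ * (S.2 + 1))

/-- The lower left corner of the half-open square of the grid of mesh `δ` that contains `a`. -/
noncomputable def gridFloor (δ : ℝ) (a : ℂ) : ℤ × ℤ := (⌊a.re / δ⌋, ⌊a.im / δ⌋)

theorem convex_gridSquare (δ : ℝ) (S : ℤ × ℤ) : Convex ℝ (gridSquare δ S) :=
  ((convex_Icc _ _).linear_preimage Complex.reLm).inter
    ((convex_Icc _ _).linear_preimage Complex.imLm)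

/-- The graph of those edges of the grid of mesh `δ` that lie in `U`. -/
def gridGraph (U : Set ℂ) (δ : ℝ) : SimpleGraph (ℤ × ℤ) where
  Adj u v := squareGrid.Adj u v ∧ segment ℝ (gridPoint δ u) (gridPoint δ v) ⊆ U
  symm := ⟨fun u v h => ⟨h.1.symm, by rw [segment_symm]; exact h.2⟩⟩
  loopless := ⟨fun u h => squareGrid.irrefl h.1⟩

theorem gridGraph_le (δ : ℝ) : gridGraph U δ ≤ squareGrid := fun _ _ h => h.1

theorem mem_segment_right {δ : ℝ} (hδ : 0 < δ) {i j : ℤ} {a : ℂ} (hre : a.re = δ * i)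
    (him : a.im ∈ Icc (δ * j) (δ * (j + 1))) :
    a ∈ segment ℝ (gridPoint δ (i, j)) (gridPoint δ (i, j + 1)) := by
  rw [segment_eq_image]
  refine ⟨a.im / δ - j, ⟨?_, ?_⟩, ?_⟩
  · rw [sub_nonneg, le_div_iff₀ hδ]; linarith [him.1]
  · rw [sub_le_iff_le_add, div_le_iff₀ hδ]; linarith [him.2]
  · apply Complex.ext
    · simp [gridPoint, hre]
      ring
    · simp [gridPoint]
      field_simp
      ring

theorem mem_segment_up {δ : ℝ} (hδ : 0 < δ) {i j : ℤ} {a : ℂ} (him : a.im = δ * j)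
    (hre : a.re ∈ Icc (δ * i) (δ * (i + 1))) :
    a ∈ segment ℝ (gridPoint δ (i, j)) (gridPoint δ (i + 1, j)) := by
  rw [segment_eq_image]
  refine ⟨a.re / δ - i, ⟨?_, ?_⟩, ?_⟩
  · rw [sub_nonneg, le_div_iff₀ hδ]; linarith [hre.1]
  · rw [sub_le_iff_le_add, div_le_iff₀ hδ]; linarith [hre.2]
  · apply Complex.ext
    · simp [gridPoint]
      field_simp
      ring
    · simp [gridPoint, him]
      ring

/-- The winding numbers of a closed walk in `U` about two squares of the grid that share a point
outside `U` agree. -/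
theorem walkSum_crossing_eq_gridFloor {δ : ℝ} (hδ : 0 < δ) {a : ℂ} (ha : a ∉ U) {S : ℤ × ℤ}
    (haS : a ∈ gridSquare δ S) {u : ℤ × ℤ} (p : (gridGraph U δ).Walk u u) :
    walkSum (crossing S) p = walkSum (crossing (gridFloor δ a)) p := by
  obtain ⟨i, j⟩ := S
  obtain ⟨⟨h1, h2⟩, h3, h4⟩ := haS
  simp only at h1 h2 h3 h4
  have hi : ⌊a.re / δ⌋ = i ∨ (⌊a.re / δ⌋ = i + 1 ∧ a.re = δ * (i + 1)) := by
    rcases h2.lt_or_eq with h | h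
    · left
      rw [Int.floor_eq_iff, le_div_iff₀ hδ, div_lt_iff₀ hδ]
      constructor <;> linarith
    · right
      refine ⟨?_, h⟩
      rw [h, mul_div_cancel_left₀ _ hδ.ne']
      exact_mod_cast Int.floor_intCast (i + 1)
  have hj : ⌊a.im / δ⌋ = j ∨ (⌊a.im / δ⌋ = j + 1 ∧ a.im = δ * (j + 1)) := by
    rcases h4.lt_or_eq with h | h
    · left
      rw [Int.floor_eq_iff, le_div_iff₀ hδ, div_lt_iff₀ hδ]
      constructor <;> linarith
    · right
      refine ⟨?_, h⟩
      rw [h, mul_div_cancel_left₀ _ hδ.ne']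
      exact_mod_cast Int.floor_intCast (j + 1)
  have e1 : walkSum (crossing (i, j)) p = walkSum (crossing (⌊a.re / δ⌋, j)) p := by
    rcases hi with h | ⟨h, h'⟩
    · rw [h]
    · rw [h]
      refine walkSum_crossing_right_eq (gridGraph_le δ) (fun hc => ha (hc.2 ?_)) p
      exact mem_segment_right hδ (by rw [h']; push_cast; rfl) ⟨h3, h4⟩
  rw [e1, gridFloor]
  rcases hj with h | ⟨h, h'⟩
  · rw [h]
  · rw [h]
    refine walkSum_crossing_up_eq (gridGraph_le δ) (fun hc => ha (hc.2 ?_)) p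
    refine mem_segment_up hδ (by rw [h']; push_cast; rfl) ⟨?_, ?_⟩
    · rw [mul_comm, ← le_div_iff₀ hδ]; exact Int.floor_le _
    · rw [mul_comm, ← div_le_iff₀ hδ]; exact (Int.lt_floor_add_one _).le

theorem eventually_mem_gridSquare_gridFloor {δ : ℝ} (hδ : 0 < δ) (a : ℂ) :
    ∀ᶠ b in 𝓝 a, a ∈ gridSquare δ (gridFloor δ b) := by
  have key : ∀ f : ℂ → ℝ, Continuous f → ∀ᶠ b in 𝓝 a,
      f a ∈ Icc (δ * ⌊f b / δ⌋) (δ * (⌊f b / δ⌋ + 1)) := by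
    intro f hf
    have hc : Tendsto (fun b => f b / δ) (𝓝 a) (𝓝 (f a / δ)) := (hf.div_const δ).tendsto a
    have h1 : (⌈f a / δ⌉ : ℝ) - 1 < f a / δ := by linarith [Int.ceil_lt_add_one (f a / δ)]
    filter_upwards [hc.eventually (lt_mem_nhds h1),
      hc.eventually (gt_mem_nhds (Int.lt_floor_add_one (f a / δ)))] with b hb1 hb2
    have h2 : ⌊f b / δ⌋ < ⌊f a / δ⌋ + 1 := by
      rw [Int.floor_lt]
      exact_mod_cast hb2
    have h3 : ⌈f a / δ⌉ - 1 ≤ ⌊f b / δ⌋ := by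
      rw [Int.le_floor]
      push_cast
      exact hb1.le
    constructor
    · rw [mul_comm, ← le_div_iff₀ hδ, ← Int.le_floor]
      omega
    · rw [mul_comm, ← div_le_iff₀ hδ]
      have : f a / δ ≤ ((⌊f b / δ⌋ + 1 : ℤ) : ℝ) := by
        rw [← Int.ceil_le]
        omega
      exact_mod_cast this
  filter_upwards [key _ Complex.continuous_re, key _ Complex.continuous_im] with b h1 h2
  exact ⟨h1, h2⟩

/-- If the complement of the bounded set `U` is connected, then a closed grid walk in `U` has
winding number zero about every square that is not contained in `U`: the winding number is locally
constant on the complement of `U` and vanishes far away. -/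
theorem walkSum_crossing_eq_zero (hb : Bornology.IsBounded U) (hc : IsPreconnected Uᶜ) {δ : ℝ}
    (hδ : 0 < δ) {S : ℤ × ℤ} (hS : ¬ gridSquare δ S ⊆ U) {u : ℤ × ℤ}
    (p : (gridGraph U δ).Walk u u) : walkSum (crossing S) p = 0 := by
  rw [not_subset] at hS
  obtain ⟨a, haS, haU⟩ := hS
  rw [walkSum_crossing_eq_gridFloor hδ haU haS]
  have hcont : ContinuousOn (fun a => walkSum (crossing (gridFloor δ a)) p) Uᶜ := by
    intro a ha
    refine (continuousWithinAt_const
      (b := walkSum (crossing (gridFloor δ a)) p)).congr_of_eventuallyEq ?_ rfl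
    filter_upwards [nhdsWithin_le_nhds (eventually_mem_gridSquare_gridFloor hδ a)] with b hb
    exact walkSum_crossing_eq_gridFloor hδ ha hb p
  obtain ⟨R, hR⟩ := hb.exists_norm_le
  obtain ⟨m, hm⟩ : ∃ m : ℤ, ∀ w ∈ p.support, w.1 ≤ m := by
    obtain ⟨m, hm⟩ := (p.support.map Prod.fst).toFinset.exists_le
    exact ⟨m, fun w hw => hm _ (by simpa using ⟨w.2, hw⟩)⟩
  set b : ℂ := ((max (R + 1) (δ * m) : ℝ) : ℂ) with hbdef
  have hbU : b ∉ U := by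
    intro h
    have h1 := hR _ h
    rw [hbdef, Complex.norm_real, Real.norm_eq_abs] at h1
    have := (le_abs_self _).trans h1
    linarith [le_max_left (R + 1) (δ * m)]
  -- The walk does not reach the ray that starts at `b`.
  rw [hc.constant hcont haU hbU]
  refine walkSum_crossing_eq_zero_of_le p fun w hw => (hm w hw).trans ?_
  rw [Int.le_floor, le_div_iff₀ hδ, hbdef, Complex.ofReal_re, mul_comm]
  exact le_max_right _ _

theorem gridGraph_adj_of_mem_convex {D : Set ℂ} (hD : Convex ℝ D) (hDU : D ⊆ U) {δ : ℝ}
    {u v : ℤ × ℤ} (huv : squareGrid.Adj u v) (hu : gridPoint δ u ∈ D) (hv : gridPoint δ v ∈ D) :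
    (gridGraph U δ).Adj u v :=
  ⟨huv, (hD.segment_subset hu hv).trans hDU⟩

theorem finite_gridSquare_subset (hb : Bornology.IsBounded U) {δ : ℝ} (hδ : 0 < δ) :
    {S | gridSquare δ S ⊆ U}.Finite := by
  obtain ⟨R, hR⟩ := hb.exists_norm_le
  obtain ⟨m, hm⟩ := exists_nat_ge (R / δ)
  rw [div_le_iff₀ hδ] at hm
  refine (((finite_Icc (-m : ℤ) m).prod (finite_Icc (-m : ℤ) m))).subset fun S hS => ?_
  have hmem : gridPoint δ S ∈ U := hS ⟨⟨le_rfl, by simp only [gridPoint]; nlinarith⟩,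
    ⟨le_rfl, by simp only [gridPoint]; nlinarith⟩⟩
  have key : ∀ k : ℤ, |δ * k| ≤ R → k ∈ Icc (-m : ℤ) m := by
    intro k hk
    rw [abs_mul, abs_of_pos hδ] at hk
    have : |(k : ℝ)| ≤ m := by
      have := hk.trans hm
      rw [mul_comm] at this
      exact le_of_mul_le_mul_right this hδ
    rw [mem_Icc, ← abs_le]
    exact_mod_cast this
  exact ⟨key _ ((Complex.abs_re_le_norm _).trans (hR _ hmem)),
    key _ ((Complex.abs_im_le_norm _).trans (hR _ hmem))⟩

open Classical in
/-- The vertices of the grid as points of `U`, with the base point `a` in the place of those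
outside `U`. -/
noncomputable def vertex (δ : ℝ) (a : U) (v : ℤ × ℤ) : FundamentalGroupoid U :=
  ⟨if h : gridPoint δ v ∈ U then ⟨gridPoint δ v, h⟩ else a⟩

theorem coe_vertex {δ : ℝ} {a : U} {v : ℤ × ℤ} (h : gridPoint δ v ∈ U) :
    ((vertex δ a v).as : ℂ) = gridPoint δ v := by
  simp [vertex, h]

open Classical in
/-- The homotopy class of the straight path in `U` between two vertices of the grid, if the
segment lies in `U`, and of any path otherwise. -/
noncomputable def edgeHom [PathConnectedSpace U] (δ : ℝ) (a : U) (u v : ℤ × ℤ) :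
    vertex δ a u ⟶ vertex δ a v :=
  if h : ∃ q : Path (vertex δ a u).as (vertex δ a v).as,
      ∀ t, (q t : ℂ) ∈ segment ℝ (gridPoint δ u) (gridPoint δ v)
  then FundamentalGroupoid.fromPath (.mk h.choose)
  else FundamentalGroupoid.fromPath (.mk (PathConnectedSpace.somePath _ _))

theorem edgeHom_eq [PathConnectedSpace U] {δ : ℝ} {a : U} {u v : ℤ × ℤ} {D : Set ℂ}
    (hD : Convex ℝ D) (hDU : D ⊆ U) (hu : gridPoint δ u ∈ D) (hv : gridPoint δ v ∈ D)
    (p : Path (vertex δ a u).as (vertex δ a v).as) (hp : ∀ t, (p t : ℂ) ∈ D) :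
    edgeHom δ a u v = FundamentalGroupoid.fromPath (.mk p) := by
  have hseg := hD.segment_subset hu hv
  have h : ∃ q : Path (vertex δ a u).as (vertex δ a v).as,
      ∀ t, (q t : ℂ) ∈ segment ℝ (gridPoint δ u) (gridPoint δ v) :=
    exists_path_mem_convex (convex_segment _ _) (hseg.trans hDU) _ _
      (by rw [coe_vertex (hDU hu)]; exact left_mem_segment _ _ _)
      (by rw [coe_vertex (hDU hv)]; exact right_mem_segment _ _ _)
  have he : edgeHom δ a u v = FundamentalGroupoid.fromPath (.mk h.choose) := dif_pos h
  rw [he]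
  exact (FundamentalGroupoid.fromPath_eq_iff_homotopic _ _).2
    (homotopic_of_convex hD hDU _ _ (fun t => hseg (h.choose_spec t)) hp)

/-- Two equal or neighbouring vertices in a convex subset of `U` are joined by a grid walk whose
homotopy class is represented by a path in that subset. -/
theorem exists_walk_step [PathConnectedSpace U] {δ : ℝ} {a : U} {u v : ℤ × ℤ} {D : Set ℂ}
    (hD : Convex ℝ D) (hDU : D ⊆ U) (huv : u = v ∨ squareGrid.Adj u v)
    (hu : gridPoint δ u ∈ D) (hv : gridPoint δ v ∈ D) :
    ∃ (w : (gridGraph U δ).Walk u v) (p : Path (vertex δ a u).as (vertex δ a v).as),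
      (∀ t, (p t : ℂ) ∈ D) ∧ walkHom (edgeHom δ a) w = FundamentalGroupoid.fromPath (.mk p) := by
  rcases huv with rfl | huv
  · refine ⟨.nil, Path.refl _, fun t => ?_, rfl⟩
    rw [Path.refl_apply, coe_vertex (hDU hu)]
    exact hu
  · obtain ⟨p, hp⟩ := exists_path_mem_convex hD hDU (vertex δ a u).as (vertex δ a v).as
      (by rwa [coe_vertex (hDU hu)]) (by rwa [coe_vertex (hDU hv)])
    refine ⟨.cons (gridGraph_adj_of_mem_convex hD hDU huv hu hv) .nil, p, hp, ?_⟩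
    rw [walkHom, walkHom, Category.comp_id, edgeHom_eq hD hDU hu hv p hp]

/-- Closed grid walks in `U` are null-homotopic in `U`. -/
theorem walkHom_edgeHom_eq_id [PathConnectedSpace U] (hb : Bornology.IsBounded U)
    (hc : IsPreconnected Uᶜ) {δ : ℝ} (hδ : 0 < δ) (a : U) {u : ℤ × ℤ}
    (p : (gridGraph U δ).Walk u u) : walkHom (edgeHom δ a) p = 𝟙 (vertex δ a u) := by
  refine GridWalk.walkHom_eq_id (finite_gridSquare_subset hb hδ).toFinset (gridGraph_le δ) ?_ ?_
    (fun S hS u p => walkSum_crossing_eq_zero hb hc hδ (by simpa using hS) p) p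
  · intro u v huv
    have hD := convex_segment (𝕜 := ℝ) (gridPoint δ u) (gridPoint δ v)
    have hu := left_mem_segment ℝ (gridPoint δ u) (gridPoint δ v)
    have hv := right_mem_segment ℝ (gridPoint δ u) (gridPoint δ v)
    obtain ⟨q, hq⟩ := exists_path_mem_convex hD huv.2 (vertex δ a u).as (vertex δ a v).as
      (by rwa [coe_vertex (huv.2 hu)]) (by rwa [coe_vertex (huv.2 hv)])
    rw [edgeHom_eq hD huv.2 hu hv q hq,
      edgeHom_eq hD huv.2 hv hu q.symm (fun t => by rw [Path.symm_apply]; exact hq _)]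
    exact (FundamentalGroupoid.fromPath_eq_iff_homotopic (q.trans q.symm) (Path.refl _)).2
      ⟨(Path.Homotopy.reflTransSymm q).symm⟩
  · intro i j hij
    simp only [Finite.mem_toFinset, mem_ofPred_eq] at hij
    have hD := convex_gridSquare δ (i, j)
    have h00 : gridPoint δ (i, j) ∈ gridSquare δ (i, j) := by
      refine ⟨⟨?_, ?_⟩, ?_, ?_⟩ <;> simp only [gridPoint] <;> nlinarith
    have h10 : gridPoint δ (i + 1, j) ∈ gridSquare δ (i, j) := by
      refine ⟨⟨?_, ?_⟩, ?_, ?_⟩ <;> simp only [gridPoint] <;> push_cast <;> nlinarith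
    have h01 : gridPoint δ (i, j + 1) ∈ gridSquare δ (i, j) := by
      refine ⟨⟨?_, ?_⟩, ?_, ?_⟩ <;> simp only [gridPoint] <;> push_cast <;> nlinarith
    have h11 : gridPoint δ (i + 1, j + 1) ∈ gridSquare δ (i, j) := by
      refine ⟨⟨?_, ?_⟩, ?_, ?_⟩ <;> simp only [gridPoint] <;> push_cast <;> nlinarith
    refine ⟨gridGraph_adj_of_mem_convex hD hij (by simp [squareGrid]) h00 h10,
      gridGraph_adj_of_mem_convex hD hij (by simp [squareGrid]) h10 h11,
      gridGraph_adj_of_mem_convex hD hij (by simp [squareGrid]) h00 h01, ?_⟩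
    have hpath : ∀ u v, gridPoint δ u ∈ gridSquare δ (i, j) → gridPoint δ v ∈ gridSquare δ (i, j) →
        ∃ q : Path (vertex δ a u).as (vertex δ a v).as, ∀ t, (q t : ℂ) ∈ gridSquare δ (i, j) := by
      intro u v hu hv
      exact exists_path_mem_convex hD hij _ _ (by rwa [coe_vertex (hij hu)])
        (by rwa [coe_vertex (hij hv)])
    obtain ⟨q1, hq1⟩ := hpath _ _ h01 h00
    obtain ⟨q2, hq2⟩ := hpath _ _ h00 h10
    obtain ⟨q3, hq3⟩ := hpath _ _ h10 h11
    have hq : ∀ t, ((q1.trans (q2.trans q3)) t : ℂ) ∈ gridSquare δ (i, j) := by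
      intro t
      simp only [Path.trans_apply]
      split_ifs
      exacts [hq1 _, hq2 _, hq3 _]
    rw [edgeHom_eq hD hij h01 h00 q1 hq1, edgeHom_eq hD hij h00 h10 q2 hq2,
      edgeHom_eq hD hij h10 h11 q3 hq3, edgeHom_eq hD hij h01 h11 _ hq]
    rfl

theorem dist_gridPoint_gridFloor_le {δ : ℝ} (hδ : 0 < δ) (a : ℂ) {v : ℤ × ℤ}
    (h1 : |⌊a.re / δ⌋ - v.1| ≤ 1) (h2 : |⌊a.im / δ⌋ - v.2| ≤ 1) :
    dist (gridPoint δ v) a ≤ 4 * δ := by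
  have key : ∀ (x : ℝ) (k : ℤ), |⌊x / δ⌋ - k| ≤ 1 → |δ * k - x| ≤ 2 * δ := by
    intro x k hk
    have e1 := Int.floor_le (x / δ)
    have e2 := Int.lt_floor_add_one (x / δ)
    rw [le_div_iff₀ hδ] at e1
    rw [div_lt_iff₀ hδ] at e2
    rw [abs_le] at hk ⊢
    have e3 : ((⌊x / δ⌋ : ℤ) : ℝ) ≤ k + 1 := by exact_mod_cast (by omega : ⌊x / δ⌋ ≤ k + 1)
    have e4 : (k : ℝ) ≤ ((⌊x / δ⌋ : ℤ) : ℝ) + 1 := by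
      exact_mod_cast (by omega : k ≤ ⌊x / δ⌋ + 1)
    constructor <;> nlinarith
  rw [dist_eq_norm]
  refine (Complex.norm_le_abs_re_add_abs_im _).trans ?_
  have := key _ _ h1
  have := key _ _ h2
  simp only [gridPoint, Complex.sub_re, Complex.sub_im]
  linarith

end PlaneDomain

namespace PlaneDomain

open CategoryTheory SimpleGraph GridWalk unitInterval

variable {U : Set ℂ}

/-- Two points of the plane at distance less than `δ` have grid vertices near them that are joined
by a walk along at most two edges. -/
theorem exists_walk_gridFloor [PathConnectedSpace U] {δ : ℝ} (hδ : 0 < δ) {c : U} {z w : ℂ}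
    {r : ℝ} (hr : 4 * δ < r) (hU : Metric.ball z r ⊆ U) (hzw : dist w z < δ) :
    ∃ (q : (gridGraph U δ).Walk (gridFloor δ z) (gridFloor δ w))
      (p : Path (vertex δ c (gridFloor δ z)).as (vertex δ c (gridFloor δ w)).as),
      (∀ t, (p t : ℂ) ∈ Metric.ball z r) ∧
        walkHom (edgeHom δ c) q = FundamentalGroupoid.fromPath (.mk p) := by
  have key : ∀ x y : ℝ, |y - x| < δ → |⌊x / δ⌋ - ⌊y / δ⌋| ≤ 1 := by
    intro x y hxy
    rw [abs_lt] at hxy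
    have e1 := Int.floor_le (x / δ)
    have e2 := Int.lt_floor_add_one (x / δ)
    have e3 := Int.floor_le (y / δ)
    have e4 := Int.lt_floor_add_one (y / δ)
    have e5 : y / δ < x / δ + 1 := by
      rw [div_add_one hδ.ne', div_lt_div_iff_of_pos_right hδ]; linarith
    have e6 : x / δ < y / δ + 1 := by
      rw [div_add_one hδ.ne', div_lt_div_iff_of_pos_right hδ]; linarith
    have e7 : ⌊x / δ⌋ < ⌊y / δ⌋ + 2 := by
      have : ((⌊x / δ⌋ : ℤ) : ℝ) < ((⌊y / δ⌋ + 2 : ℤ) : ℝ) := by push_cast; linarith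
      exact_mod_cast this
    have e8 : ⌊y / δ⌋ < ⌊x / δ⌋ + 2 := by
      have : ((⌊y / δ⌋ : ℤ) : ℝ) < ((⌊x / δ⌋ + 2 : ℤ) : ℝ) := by push_cast; linarith
      exact_mod_cast this
    rw [abs_le]
    omega
  rw [dist_eq_norm] at hzw
  have hre := key z.re w.re (((Complex.abs_re_le_norm (w - z))).trans_lt hzw)
  have him := key z.im w.im (((Complex.abs_im_le_norm (w - z))).trans_lt hzw)
  have hD := convex_ball z r
  have m : ∀ v : ℤ × ℤ, |⌊z.re / δ⌋ - v.1| ≤ 1 → |⌊z.im / δ⌋ - v.2| ≤ 1 →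
      gridPoint δ v ∈ Metric.ball z r := fun v h1 h2 =>
    (dist_gridPoint_gridFloor_le hδ z h1 h2).trans_lt hr
  have m1 := m (gridFloor δ z) (by simp [gridFloor]) (by simp [gridFloor])
  have m2 := m (⌊w.re / δ⌋, ⌊z.im / δ⌋) hre (by simp)
  have m3 := m (gridFloor δ w) hre him
  obtain ⟨q1, p1, hp1, h1⟩ := exists_walk_step (a := c) hD hU (u := gridFloor δ z)
    (v := (⌊w.re / δ⌋, ⌊z.im / δ⌋)) (by
      have : ⌊z.re / δ⌋ = ⌊w.re / δ⌋ ∨ ⌊w.re / δ⌋ = ⌊z.re / δ⌋ + 1 ∨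
          ⌊z.re / δ⌋ = ⌊w.re / δ⌋ + 1 := by rw [abs_le] at hre; omega
      rcases this with h | h | h <;> simp [gridFloor, squareGrid, h]) m1 m2
  obtain ⟨q2, p2, hp2, h2⟩ := exists_walk_step (a := c) hD hU
    (u := (⌊w.re / δ⌋, ⌊z.im / δ⌋)) (v := gridFloor δ w) (by
      have : ⌊z.im / δ⌋ = ⌊w.im / δ⌋ ∨ ⌊w.im / δ⌋ = ⌊z.im / δ⌋ + 1 ∨
          ⌊z.im / δ⌋ = ⌊w.im / δ⌋ + 1 := by rw [abs_le] at him; omega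
      rcases this with h | h | h <;> simp [gridFloor, squareGrid, h]) m2 m3
  refine ⟨q1.append q2, p1.trans p2, fun t => ?_, ?_⟩
  · simp only [Path.trans_apply]
    split_ifs
    exacts [hp1 _, hp2 _]
  · rw [walkHom_append, h1, h2]
    rfl

theorem subpath_mem_ball {X : Type*} [PseudoMetricSpace X] {a b c : X} (γ : Path a b) {s t : I}
    {r : ℝ} (h : ∀ u ∈ uIcc s t, γ u ∈ Metric.ball c r) (u : I) :
    γ.subpath s t u ∈ Metric.ball c r := by
  have : γ.subpath s t u ∈ range (γ.subpath s t) := mem_range_self u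
  rw [Path.range_subpath] at this
  obtain ⟨v, hv, hv'⟩ := this
  rw [← hv']
  exact h v hv

/-- Cut into short pieces, a loop in `U` is homotopic to a closed grid walk in `U`, conjugated by a
short path from the base point to a vertex, and closed grid walks are null-homotopic. -/
theorem loop_nullhomotopic (hU : IsOpen U) [PathConnectedSpace U] (hb : Bornology.IsBounded U)
    (hc : IsPreconnected Uᶜ) {a : U} (γ : Path a a) : γ.Homotopic (Path.refl a) := by
  obtain ⟨r, hr, hrU⟩ : ∃ r > 0, ∀ t, Metric.ball (γ t : ℂ) r ⊆ U := by
    have hK : IsCompact (range fun t => (γ t : ℂ)) :=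
      isCompact_range (by fun_prop)
    obtain ⟨r, hr, h⟩ := hK.exists_thickening_subset_open hU (by rintro _ ⟨t, rfl⟩; exact (γ t).2)
    exact ⟨r, hr, fun t => (Metric.ball_subset_thickening (mem_range_self t) r).trans h⟩
  set δ := r / 8 with hδdef
  have hδ : 0 < δ := by positivity
  have hr4 : 4 * δ < r := by linarith
  -- `v t` is the grid vertex near `γ t`, and `ℓ t` is a short path in `U` that leads there.
  set v : I → ℤ × ℤ := fun t => gridFloor δ (γ t) with hv
  have hvert5 : ∀ t, gridPoint δ (v t) ∈ Metric.ball (γ t : ℂ) (5 * δ) := fun t =>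
    (dist_gridPoint_gridFloor_le hδ _ (by simp [hv, gridFloor]) (by simp [hv, gridFloor])).trans_lt
      (by linarith)
  have hball5 : ∀ t, Metric.ball (γ t : ℂ) (5 * δ) ⊆ U := fun t =>
    (Metric.ball_subset_ball (by linarith)).trans (hrU t)
  have hℓ : ∀ t, ∃ ℓ : Path (γ t) (vertex δ a (v t)).as,
      ∀ s, (ℓ s : ℂ) ∈ Metric.ball (γ t : ℂ) (5 * δ) := fun t =>
    exists_path_mem_convex (convex_ball _ _) (hball5 t) _ _ (Metric.mem_ball_self (by positivity))
      (by rw [coe_vertex (hball5 t (hvert5 t))]; exact hvert5 t)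
  choose ℓ hℓ using hℓ
  obtain ⟨η, hη, hγη⟩ := Metric.uniformContinuous_iff.1
    (CompactSpace.uniformContinuous_of_continuous (show Continuous fun t => (γ t : ℂ) by fun_prop))
    δ hδ
  obtain ⟨N, hN⟩ := exists_nat_one_div_lt hη
  set τ : ℕ → I := fun k => projIcc 0 1 zero_le_one (k / (N + 1)) with hτ
  have hN1 : (0 : ℝ) < N + 1 := by positivity
  have hτsucc : ∀ k, ∀ u ∈ uIcc (τ k) (τ (k + 1)), dist (γ u : ℂ) (γ (τ k)) < δ := by
    intro k u hu
    apply hγη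
    have hmono : τ k ≤ τ (k + 1) := monotone_projIcc _ (by gcongr; linarith)
    rw [uIcc_of_le hmono] at hu
    have h1 : dist u (τ k) ≤ dist (τ (k + 1)) (τ k) := by
      rw [Subtype.dist_eq, Subtype.dist_eq, Real.dist_eq, Real.dist_eq,
        abs_of_nonneg (sub_nonneg.2 (Subtype.coe_le_coe.2 hu.1)),
        abs_of_nonneg (sub_nonneg.2 (Subtype.coe_le_coe.2 hmono))]
      exact sub_le_sub_right (Subtype.coe_le_coe.2 hu.2) _
    refine (h1.trans ?_).trans_lt hN
    rw [Subtype.dist_eq, Real.dist_eq, hτ]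
    refine (abs_projIcc_sub_projIcc zero_le_one).trans ?_
    rw [← sub_div]
    push_cast
    rw [add_sub_cancel_left, abs_of_pos (by positivity)]
  -- Up to its point with parameter `τ k`, the loop is homotopic to a grid walk.
  have hcl : ∀ k, ∃ q : (gridGraph U δ).Walk (v 0) (v (τ k)),
      FundamentalGroupoid.fromPath (.mk ((γ.subpath 0 (τ k)).trans (ℓ (τ k)))) =
        FundamentalGroupoid.fromPath (.mk (ℓ 0)) ≫ walkHom (edgeHom δ a) q := by
    intro k
    induction k with
    | zero =>
      have h0 : τ 0 = 0 := by simp [hτ]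
      rw [h0]
      refine ⟨.nil, ?_⟩
      rw [walkHom, Category.comp_id, Path.subpath_self]
      exact (FundamentalGroupoid.fromPath_eq_iff_homotopic _ _).2 ⟨Path.Homotopy.reflTrans _⟩
    | succ k ih =>
      obtain ⟨q, hq⟩ := ih
      obtain ⟨q', p, hp, hpq⟩ := exists_walk_gridFloor (c := a) hδ hr4 (hrU (τ k))
        (hτsucc k (τ (k + 1)) right_mem_uIcc)
      refine ⟨q.append q', ?_⟩
      rw [walkHom_append, ← Category.assoc, ← hq, hpq]
      refine (FundamentalGroupoid.fromPath_eq_iff_homotopic _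
        (((γ.subpath 0 (τ k)).trans (ℓ (τ k))).trans p)).2 ?_
      have e1 : ((γ.subpath 0 (τ k)).trans (γ.subpath (τ k) (τ (k + 1)))).Homotopic
          (γ.subpath 0 (τ (k + 1))) := ⟨Path.Homotopy.subpathTransSubpath _ _ _ _⟩
      have e2 : ((γ.subpath (τ k) (τ (k + 1))).trans (ℓ (τ (k + 1)))).Homotopic
          ((ℓ (τ k)).trans p) := by
        refine homotopic_of_convex (convex_ball (γ (τ k) : ℂ) r) (hrU (τ k)) _ _ ?_ ?_
        · intro t
          simp only [Path.trans_apply]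
          split_ifs
          · exact subpath_mem_ball γ (c := γ (τ k)) (r := r)
              (fun u hu => (hτsucc k u hu).trans (by linarith)) _
          · refine Metric.ball_subset_ball' ?_ (hℓ (τ (k + 1)) _)
            have := hτsucc k (τ (k + 1)) right_mem_uIcc
            linarith
        · intro t
          simp only [Path.trans_apply]
          split_ifs
          · exact Metric.ball_subset_ball (by linarith) (hℓ (τ k) _)
          · exact hp _
      refine (e1.symm.hcomp (.refl _)).trans ?_
      refine Path.Homotopic.trans ⟨Path.Homotopy.transAssoc _ _ _⟩ ?_
      refine ((Path.Homotopic.refl _).hcomp e2).trans ?_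
      exact ⟨(Path.Homotopy.transAssoc _ _ _).symm⟩
  have hτN : τ (N + 1) = 1 := by
    simp only [hτ]
    push_cast
    rw [div_self hN1.ne']
    exact projIcc_right (h := zero_le_one)
  have h1 := hcl (N + 1)
  rw [hτN] at h1
  obtain ⟨q, hq⟩ := h1
  -- The end points of the loop agree only propositionally, hence the generalization.
  have hfin : ∀ (b b' : U) (hb₀ : b = a) (hb₁ : b' = a)
      (ℓ₀ : Path b (vertex δ a (gridFloor δ b)).as) (ℓ₁ : Path b' (vertex δ a (gridFloor δ b')).as),
      (∀ s, (ℓ₀ s : ℂ) ∈ Metric.ball (b : ℂ) (5 * δ)) →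
      (∀ s, (ℓ₁ s : ℂ) ∈ Metric.ball (b' : ℂ) (5 * δ)) → Metric.ball (b : ℂ) (5 * δ) ⊆ U →
      ∀ q : (gridGraph U δ).Walk (gridFloor δ b) (gridFloor δ b'),
      FundamentalGroupoid.fromPath (.mk ((γ.cast hb₀ hb₁).trans ℓ₁)) =
        FundamentalGroupoid.fromPath (.mk ℓ₀) ≫ walkHom (edgeHom δ a) q →
      γ.Homotopic (Path.refl a) := by
    rintro b b' rfl rfl ℓ₀ ℓ₁ h₀ h₁ hbU q hq
    rw [walkHom_edgeHom_eq_id hb hc hδ, Category.comp_id] at hq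
    have e1 := (FundamentalGroupoid.fromPath_eq_iff_homotopic _ _).1 hq
    have e2 := homotopic_of_convex (convex_ball _ _) hbU ℓ₀ ℓ₁ h₀ h₁
    have e3 : (γ.trans ℓ₁).Homotopic ℓ₁ := e1.trans e2
    have e4 : ((γ.trans ℓ₁).trans ℓ₁.symm).Homotopic (ℓ₁.trans ℓ₁.symm) := e3.hcomp (.refl _)
    have e5 : (ℓ₁.trans ℓ₁.symm).Homotopic (Path.refl b') :=
      ⟨(Path.Homotopy.reflTransSymm _).symm⟩
    have e6 : ((γ.trans ℓ₁).trans ℓ₁.symm).Homotopic (γ.trans (ℓ₁.trans ℓ₁.symm)) :=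
      ⟨Path.Homotopy.transAssoc _ _ _⟩
    have e7 : (γ.trans (Path.refl b')).Homotopic γ := ⟨Path.Homotopy.transRefl _⟩
    exact (e7.symm.trans (((Path.Homotopic.refl γ).hcomp e5.symm).trans e6.symm)).trans
      (e4.trans e5)
  refine hfin (γ 0) (γ 1) γ.source γ.target (ℓ 0) (ℓ 1) (hℓ 0) (hℓ 1) (hball5 0) q ?_
  rw [← hq, Path.subpath_zero_one]

/-- A bounded plane domain with connected complement is simply connected. -/
theorem isSimplyConnected_of_isPreconnected_compl (hU : IsOpen U) (hconn : IsConnected U)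
    (hb : Bornology.IsBounded U) (hc : IsPreconnected Uᶜ) : IsSimplyConnected U := by
  have hpc : IsPathConnected U := (hU.isConnected_iff_isPathConnected).1 hconn
  have : PathConnectedSpace U := isPathConnected_iff_pathConnectedSpace.1 hpc
  exact simply_connected_iff_loops_nullhomotopic.2
    ⟨this, fun _ γ => loop_nullhomotopic hU hb hc γ⟩

end PlaneDomain

/-! ### The boundary of a bounded plane domain with connected complement -/

namespace PlaneDomain

theorem isDiscrete_setOf_exp_eq_one : IsDiscrete {w : ℂ | Complex.exp w = 1} := by
  rw [isDiscrete_iff_discreteTopology]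
  exact (Complex.isCoveringMapOn_exp 1 one_ne_zero).discreteTopology_fiber

theorem inter_frontier_nonempty_of_isPreconnected {s t : Set ℂ} (hs : IsPreconnected s)
    (ht : IsOpen t) (h1 : (s ∩ t).Nonempty) (h2 : (s ∩ tᶜ).Nonempty) :
    (s ∩ frontier t).Nonempty := by
  by_contra hne
  rw [not_nonempty_iff_eq_empty, ht.frontier_eq] at hne
  have hsub : s ⊆ t ∪ (closure t)ᶜ := by
    intro z hz
    by_contra hz'
    simp only [mem_union, mem_compl_iff, not_or, not_not] at hz'
    exact (hne ▸ ⟨hz, hz'.2, hz'.1⟩ : z ∈ (∅ : Set ℂ))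
  obtain ⟨w, hw⟩ := h2
  obtain ⟨z, -, hz1, hz2⟩ := hs t (closure t)ᶜ ht isClosed_closure.isOpen_compl hsub h1
    ⟨w, hw.1, (hsub hw.1).resolve_left hw.2⟩
  exact hz2 (subset_closure hz1)

/-- The plane is unicoherent: two closed connected sets that cover it have a connected
intersection. A separation of the intersection would give a continuous map from the plane to the
circle, built from opposite arguments on the two sets, that has no continuous logarithm. -/
theorem isPreconnected_inter_of_union_eq_univ {P Q : Set ℂ} (hP : IsClosed P) (hQ : IsClosed Q)
    (hPc : IsPreconnected P) (hQc : IsPreconnected Q) (hPQ : P ∪ Q = univ) :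
    IsPreconnected (P ∩ Q) := by
  rw [isPreconnected_closed_iff]
  intro A B hA hB hAB hA' hB'
  by_contra hne
  rw [not_nonempty_iff_eq_empty] at hne
  obtain ⟨α, hα, hαA⟩ := hA'
  obtain ⟨β, hβ, hβB⟩ := hB'
  have hdisj : Disjoint (P ∩ Q ∩ A) (P ∩ Q ∩ B) := by
    rw [disjoint_iff_inter_eq_empty, ← hne]
    ext z
    simp only [mem_inter_iff]
    tauto
  obtain ⟨f, hf0, hf1, -⟩ := exists_continuous_zero_one_of_isClosed
    ((hP.inter hQ).inter hA) ((hP.inter hQ).inter hB) hdisj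
  have hagree : ∀ z ∈ P ∩ Q, Complex.exp (Real.pi * f z * Complex.I) =
      Complex.exp (-(Real.pi * f z * Complex.I)) := by
    intro z hz
    rcases hAB hz with h | h
    · simp [hf0 ⟨hz, h⟩]
    · simp [hf1 ⟨hz, h⟩, Complex.exp_neg, Complex.exp_pi_mul_I]
  classical
  set F := P.piecewise (fun z => Complex.exp (Real.pi * f z * Complex.I))
    (fun z => Complex.exp (-(Real.pi * f z * Complex.I))) with hFdef
  have hFP : ∀ z ∈ P, F z = Complex.exp (Real.pi * f z * Complex.I) := fun z hz =>
    piecewise_eq_of_mem _ _ _ hz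
  have hFQ : ∀ z ∈ Q, F z = Complex.exp (-(Real.pi * f z * Complex.I)) := by
    intro z hz
    by_cases hzP : z ∈ P
    · rw [hFP z hzP, hagree z ⟨hzP, hz⟩]
    · exact piecewise_eq_of_notMem _ _ _ hzP
  have hF : Continuous F := by
    refine continuous_piecewise ?_ (by fun_prop) (by fun_prop)
    intro z hz
    refine hagree z ⟨hP.frontier_subset hz, ?_⟩
    rw [frontier_eq_closure_inter_closure] at hz
    exact closure_minimal (fun w hw => (hPQ.symm ▸ mem_univ w : w ∈ P ∪ Q).resolve_left hw) hQ hz.2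
  have huniv : IsSimplyConnected (univ : Set ℂ) :=
    (Homeomorph.Set.univ ℂ).toHomotopyEquiv.simplyConnectedSpace
  obtain ⟨θ, hθ, hθe⟩ := Complex.exists_continuousOn_eqOn_exp_comp huniv isOpen_univ
    hF.continuousOn (by
      rintro ⟨z, -, hz⟩
      by_cases h : z ∈ P
      · rw [hFP z h] at hz
        exact Complex.exp_ne_zero _ hz
      · rw [hFQ z ((hPQ.symm ▸ mem_univ z : z ∈ P ∪ Q).resolve_left h)] at hz
        exact Complex.exp_ne_zero _ hz)
  rw [continuousOn_univ] at hθ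
  have e1 := hPc.constant_of_mapsTo isDiscrete_setOf_exp_eq_one
    (f := fun z => θ z - Real.pi * f z * Complex.I) (by fun_prop) (fun z hz => by
      have : Complex.exp (θ z) = F z := hθe (mem_univ z)
      change Complex.exp _ = 1
      rw [Complex.exp_sub, this, hFP z hz, div_self (Complex.exp_ne_zero _)]) hα.1 hβ.1
  have e2 := hQc.constant_of_mapsTo isDiscrete_setOf_exp_eq_one
    (f := fun z => θ z - -(Real.pi * f z * Complex.I)) (by fun_prop) (fun z hz => by
      have : Complex.exp (θ z) = F z := hθe (mem_univ z)
      change Complex.exp _ = 1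
      rw [Complex.exp_sub, this, hFQ z hz, div_self (Complex.exp_ne_zero _)]) hα.2 hβ.2
  have h0 : f α = 0 := hf0 ⟨hα, hαA⟩
  have h1 : f β = 1 := hf1 ⟨hβ, hβB⟩
  simp only [h0, h1] at e1 e2
  apply Complex.two_pi_I_ne_zero
  push_cast at e1 e2
  linear_combination e1 - e2

theorem isPreconnected_frontier {U : Set ℂ} (hU : IsOpen U) (hconn : IsPreconnected U)
    (hc : IsPreconnected Uᶜ) : IsPreconnected (frontier U) := by
  rw [hU.frontier_eq, sdiff_eq]
  exact isPreconnected_inter_of_union_eq_univ isClosed_closure hU.isClosed_compl hconn.closure hc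
    (eq_univ_of_forall fun z => (em (z ∈ U)).imp (fun h => subset_closure h) id)

/-! ### Components of open plane sets -/

theorem frontier_connectedComponentIn_subset {F : Set ℂ} (hF : IsOpen F) (z : ℂ) :
    frontier (connectedComponentIn F z) ⊆ Fᶜ := by
  intro w hw hwF
  have ho : IsOpen (connectedComponentIn F z) := hF.connectedComponentIn
  rw [ho.frontier_eq] at hw
  obtain ⟨y, hy1, hy2⟩ := mem_closure_iff.1 hw.1 _ hF.connectedComponentIn
    (mem_connectedComponentIn hwF)
  apply hw.2
  rw [connectedComponentIn_eq hy2, ← connectedComponentIn_eq hy1]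
  exact mem_connectedComponentIn hwF

/-- If all components of the open set `F` are bounded with connected complement, then the
complement of `F` is connected: every component has a connected boundary, which lies on one side of
a separation of the complement, and adding the component to that side would separate the plane. -/
theorem isConnected_compl_of_components {F : Set ℂ} (hF : IsOpen F)
    (hb : ∀ z ∈ F, Bornology.IsBounded (connectedComponentIn F z))
    (hc : ∀ z ∈ F, IsPreconnected (connectedComponentIn F z)ᶜ) : IsConnected Fᶜ := by
  have hne_univ : ∀ z ∈ F, connectedComponentIn F z ≠ univ := fun z hz h =>
    NormedSpace.unbounded_univ ℝ ℂ (h ▸ hb z hz)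
  have hfr_ne : ∀ z ∈ F, (frontier (connectedComponentIn F z)).Nonempty := fun z hz =>
    nonempty_frontier_iff.2 ⟨⟨z, mem_connectedComponentIn hz⟩, hne_univ z hz⟩
  have hne : Fᶜ.Nonempty := by
    by_cases h : F.Nonempty
    · obtain ⟨z, hz⟩ := h
      exact (hfr_ne z hz).mono (frontier_connectedComponentIn_subset hF z)
    · rw [not_nonempty_iff_eq_empty.1 h, compl_empty]
      exact univ_nonempty
  refine ⟨hne, ?_⟩
  rw [isPreconnected_closed_iff]
  intro A B hA hB hAB hA' hB'
  by_contra hdis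
  -- The union of one side with all components whose boundary it contains is closed.
  have hclosed : ∀ A : Set ℂ, IsClosed A →
      IsClosed (Fᶜ ∩ A ∪ {z | z ∈ F ∧ frontier (connectedComponentIn F z) ⊆ A}) := by
    intro A hA
    rw [← closure_subset_iff_isClosed]
    intro z hz
    by_cases hzF : z ∈ F
    · obtain ⟨w, hw1, hw2⟩ := mem_closure_iff.1 hz _ hF.connectedComponentIn
        (mem_connectedComponentIn hzF)
      have hwF : w ∈ F := connectedComponentIn_subset _ _ hw1
      rcases hw2 with hw2 | hw2
      · exact absurd hwF hw2.1
      · refine Or.inr ⟨hzF, ?_⟩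
        rw [connectedComponentIn_eq hw1]
        exact hw2.2
    · refine Or.inl ⟨hzF, ?_⟩
      rw [← hA.closure_eq, Metric.mem_closure_iff]
      intro ε hε
      obtain ⟨w, hw1, hw2⟩ := Metric.mem_closure_iff.1 hz ε hε
      rcases hw1 with hw1 | hw1
      · exact ⟨w, hw1.2, hw2⟩
      · obtain ⟨y, hy1, hy2⟩ := inter_frontier_nonempty_of_isPreconnected
          (convex_ball z ε).isPreconnected hF.connectedComponentIn
          ⟨w, by simpa [dist_comm] using hw2, mem_connectedComponentIn hw1.1⟩
          ⟨z, Metric.mem_ball_self hε, fun h => hzF (connectedComponentIn_subset _ _ h)⟩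
        exact ⟨y, hw1.2 hy2, by simpa [dist_comm] using hy1⟩
  have hcover : (univ : Set ℂ) ⊆
      (Fᶜ ∩ A ∪ {z | z ∈ F ∧ frontier (connectedComponentIn F z) ⊆ A}) ∪
        (Fᶜ ∩ B ∪ {z | z ∈ F ∧ frontier (connectedComponentIn F z) ⊆ B}) := by
    intro z _
    by_cases hz : z ∈ F
    · have hpre := isPreconnected_frontier hF.connectedComponentIn
        isPreconnected_connectedComponentIn (hc z hz)
      have hsub := (frontier_connectedComponentIn_subset hF z)
      rw [isPreconnected_closed_iff] at hpre
      by_cases h1 : (frontier (connectedComponentIn F z) ∩ A).Nonempty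
      · by_cases h2 : (frontier (connectedComponentIn F z) ∩ B).Nonempty
        · exact absurd ((hpre A B hA hB (hsub.trans hAB) h1 h2).mono
            (inter_subset_inter_left _ hsub)) hdis
        · refine Or.inl (Or.inr ⟨hz, fun y hy => (hAB (hsub hy)).resolve_right fun h => ?_⟩)
          exact h2 ⟨y, hy, h⟩
      · refine Or.inr (Or.inr ⟨hz, fun y hy => (hAB (hsub hy)).resolve_left fun h => ?_⟩)
        exact h1 ⟨y, hy, h⟩
    · exact (hAB hz).imp (fun h => Or.inl ⟨hz, h⟩) (fun h => Or.inl ⟨hz, h⟩)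
  obtain ⟨z, -, hz1, hz2⟩ := isPreconnected_closed_iff.1 isPreconnected_univ _ _ (hclosed A hA)
    (hclosed B hB) hcover (by simpa using hA'.mono subset_union_left)
    (by simpa using hB'.mono subset_union_left)
  rcases hz1 with hz1 | hz1 <;> rcases hz2 with hz2 | hz2
  · exact hdis ⟨z, hz1.1, hz1.2, hz2.2⟩
  · exact hz1.1 hz2.1
  · exact hz2.1 hz1.1
  · obtain ⟨y, hy⟩ := hfr_ne z hz1.1
    exact hdis ⟨y, frontier_connectedComponentIn_subset hF z hy, hz1.2 hy, hz2.2 hy⟩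

end PlaneDomain

/-! ### Normal families -/

namespace TranscendentalSemigroup

theorem IsNormalOn.mono {𝓕 𝓖 : Set (ℂ → ℂ)} {U : Set ℂ} (h : IsNormalOn 𝓖 U) (hs : 𝓕 ⊆ 𝓖) :
    IsNormalOn 𝓕 U := fun s hs' => h s fun k => hs (hs' k)

theorem normalitySet_anti {𝓕 𝓖 : Set (ℂ → ℂ)} (hs : 𝓕 ⊆ 𝓖) : normalitySet 𝓖 ⊆ normalitySet 𝓕 := by
  rintro z ⟨U, hU, hc, hz, hn⟩
  exact ⟨U, hU, hc, hz, hn.mono hs⟩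

/-- Montel's theorem for a uniformly bounded family: Cauchy's estimate makes it equicontinuous, so
the theorem of Arzelà and Ascoli applies. -/
theorem isNormalOn_ball_of_bounded {𝓕 : Set (ℂ → ℂ)} (hd : ∀ f ∈ 𝓕, Differentiable ℂ f) {z : ℂ}
    {r M : ℝ} (hr : 0 < r) (hb : ∀ f ∈ 𝓕, ∀ w ∈ Metric.closedBall z (2 * r), ‖f w‖ ≤ M) :
    IsNormalOn 𝓕 (Metric.ball z r) := by
  intro s hs
  left
  set K := Metric.closedBall z r with hK
  have : CompactSpace K := isCompact_iff_compactSpace.1 (isCompact_closedBall z r)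
  have hM : 0 ≤ M := (norm_nonneg _).trans
    (hb _ (hs 0) z (Metric.mem_closedBall_self (by positivity)))
  have hlip : ∀ k, ∀ x ∈ K, ∀ y ∈ K, ‖s k x - s k y‖ ≤ M / r * ‖x - y‖ := by
    intro k x hx y hy
    refine (convex_closedBall z r).norm_image_sub_le_of_norm_deriv_le
      (fun w _ => hd _ (hs k) w) (fun w hw => ?_) hy hx
    refine Complex.norm_deriv_le_of_forall_mem_sphere_norm_le hr
      (hd _ (hs k)).diffContOnCl fun v hv => hb _ (hs k) v ?_
    rw [Metric.mem_closedBall] at hw ⊢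
    rw [Metric.mem_sphere] at hv
    linarith [dist_triangle v w z]
  let S : ℕ → BoundedContinuousFunction K ℂ := fun k =>
    BoundedContinuousFunction.mkOfCompact ⟨fun x => s k x, by
      have := (hd _ (hs k)).continuous
      fun_prop⟩
  have hcpt : IsCompact (closure (range S)) := by
    refine BoundedContinuousFunction.arzela_ascoli (Metric.closedBall 0 M)
      (isCompact_closedBall _ _) _ ?_ ?_
    · rintro _ x ⟨k, rfl⟩
      rw [mem_closedBall_zero_iff]
      exact hb _ (hs k) x (Metric.closedBall_subset_closedBall (by linarith) x.2)
    · refine UniformEquicontinuous.equicontinuous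
        (LipschitzWith.uniformEquicontinuous _ (M / r).toNNReal ?_)
      rintro ⟨_, k, rfl⟩
      refine LipschitzWith.of_dist_le_mul fun x y => ?_
      rw [Real.coe_toNNReal _ (by positivity), dist_eq_norm, Subtype.dist_eq, dist_eq_norm]
      exact hlip k x x.2 y y.2
  obtain ⟨h, -, φ, hφ, hlim⟩ := hcpt.tendsto_subseq fun k => subset_closure (mem_range_self k)
  rw [BoundedContinuousFunction.tendsto_iff_tendstoUniformly] at hlim
  classical
  refine ⟨φ, hφ, fun w => if hw : w ∈ K then h ⟨w, hw⟩ else 0, ?_⟩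
  have hu : TendstoUniformlyOn (fun k => s (φ k)) (fun w => if hw : w ∈ K then h ⟨w, hw⟩ else 0)
      atTop K := by
    rw [tendstoUniformlyOn_iff_tendstoUniformly_comp_coe]
    convert! hlim using 1
    ext x
    simp
  exact (hu.mono Metric.ball_subset_closedBall).tendstoLocallyUniformlyOn

/-- The sequence `s` converges to `∞` uniformly near `z`. -/
def TendstoInftyNear (s : ℕ → ℂ → ℂ) (z : ℂ) : Prop :=
  ∀ M : ℝ, ∃ t ∈ 𝓝 z, ∀ᶠ k in atTop, ∀ w ∈ t, M < ‖s k w‖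

theorem TendstoInftyLocallyUniformlyOn.tendstoInftyNear {s : ℕ → ℂ → ℂ} {U : Set ℂ}
    (h : TendstoInftyLocallyUniformlyOn s U) (hU : IsOpen U) {z : ℂ} (hz : z ∈ U) :
    TendstoInftyNear s z := by
  intro M
  obtain ⟨t, ht, h'⟩ := h M z hz
  rw [hU.nhdsWithin_eq hz] at ht
  exact ⟨t, ht, h'⟩

/-- On an open set where the family is normal, a sequence that converges to `∞` near one point
does so near all points. -/
theorem IsNormalOn.tendstoInftyNear {𝓕 : Set (ℂ → ℂ)} {N : Set ℂ} (hN : IsNormalOn 𝓕 N)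
    (ho : IsOpen N) {s : ℕ → ℂ → ℂ} (hs : ∀ k, s k ∈ 𝓕) {z w : ℂ} (hz : z ∈ N) (hw : w ∈ N)
    (h : TendstoInftyNear s z) : TendstoInftyNear s w := by
  by_contra hcon
  simp only [TendstoInftyNear, not_forall, not_exists, not_and] at hcon
  obtain ⟨M, hM⟩ := hcon
  obtain ⟨ψ, hψ, hψM⟩ := extraction_forall_of_frequently
    (P := fun n k => ∃ v ∈ Metric.ball w (1 / (n + 1)), ‖s k v‖ ≤ M) (by
      intro n
      have := hM _ (Metric.ball_mem_nhds w (by positivity : (0 : ℝ) < 1 / (n + 1)))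
      rw [not_eventually] at this
      refine this.mono fun k hk => ?_
      push Not at hk
      exact hk)
  rcases hN (fun k => s (ψ k)) (fun k => hs _) with ⟨φ, hφ, l, hl⟩ | ⟨φ, hφ, hl⟩
  · obtain ⟨t, ht, hev⟩ := h (‖l z‖ + 1)
    have h1 := (hl.tendsto_at hz).norm
    have h2 := (hψ.tendsto_atTop.comp hφ.tendsto_atTop).eventually hev
    obtain ⟨k, hk1, hk2⟩ := ((h1.eventually (gt_mem_nhds (lt_add_one _))).and h2).exists
    exact lt_asymm hk1 (hk2 z (mem_of_mem_nhds ht))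
  · obtain ⟨t, ht, hev⟩ := hl.tendstoInftyNear ho hw M
    obtain ⟨ε, hε, hεt⟩ := Metric.mem_nhds_iff.1 ht
    have h1 := (tendsto_one_div_add_atTop_nhds_zero_nat (𝕜 := ℝ)).comp hφ.tendsto_atTop
    obtain ⟨k, hk1, hk2⟩ := ((h1.eventually (gt_mem_nhds hε)).and hev).exists
    obtain ⟨v, hv, hvM⟩ := hψM (φ k)
    exact (hk2 v (hεt (Metric.ball_subset_ball hk1.le hv))).not_ge hvM

/-- On a component of the set of normality, a sequence that converges to `∞` near one point
converges to `∞` locally uniformly. -/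
theorem tendstoInfty_connectedComponentIn {𝓕 : Set (ℂ → ℂ)} {s : ℕ → ℂ → ℂ} (hs : ∀ k, s k ∈ 𝓕)
    {z w : ℂ} (hw : w ∈ connectedComponentIn (normalitySet 𝓕) z) (h : TendstoInftyNear s w) :
    TendstoInftyLocallyUniformlyOn s (connectedComponentIn (normalitySet 𝓕) z) := by
  have hopen : ∀ P : ℂ → Prop, (∀ N, IsOpen N → IsNormalOn 𝓕 N → ∀ x ∈ N, ∀ y ∈ N, P x → P y) →
      IsOpen {x | x ∈ normalitySet 𝓕 ∧ P x} := by
    intro P hP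
    rw [isOpen_iff_mem_nhds]
    rintro x ⟨⟨N, hNo, hNc, hxN, hNn⟩, hx⟩
    exact mem_of_superset (hNo.mem_nhds hxN) fun y hy =>
      ⟨⟨N, hNo, hNc, hy, hNn⟩, hP N hNo hNn x hxN y hy hx⟩
  have h1 := hopen (TendstoInftyNear s) fun N hNo hNn x hx y hy =>
    hNn.tendstoInftyNear hNo hs hx hy
  have h2 := hopen (fun x => ¬ TendstoInftyNear s x) fun N hNo hNn x hx y hy hnx hy' =>
    hnx (hNn.tendstoInftyNear hNo hs hy hx hy')
  have hsub := isPreconnected_connectedComponentIn.subset_left_of_subset_union h1 h2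
    (disjoint_left.2 fun x hx hx' => hx'.2 hx.2)
    (fun x hx => (em (TendstoInftyNear s x)).imp
      (fun h => ⟨connectedComponentIn_subset _ _ hx, h⟩)
      (fun h => ⟨connectedComponentIn_subset _ _ hx, h⟩))
    ⟨w, hw, connectedComponentIn_subset _ _ hw, h⟩
  intro M x hx
  obtain ⟨t, ht, hev⟩ := (hsub hx).2 M
  exact ⟨t, mem_nhdsWithin_of_mem_nhds ht, hev⟩

/-- If `∞` is not a limit function on a component of the set of normality, then the family is
locally bounded there: of functions that take large values near a point, no subsequence has a
finite limit there, so that some subsequence tends to `∞` on the whole component. -/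
theorem exists_ball_bounded {𝓕 : Set (ℂ → ℂ)} (hd : ∀ f ∈ 𝓕, Differentiable ℂ f) {z : ℂ}
    (hz : z ∈ normalitySet 𝓕)
    (hinf : ∀ s : ℕ → ℂ → ℂ, (∀ k, s k ∈ 𝓕) →
      ¬ InftyIsLimitFunction s (connectedComponentIn (normalitySet 𝓕) z)) :
    ∃ r > 0, ∃ M : ℝ, ∀ f ∈ 𝓕, ∀ w ∈ Metric.ball z r, ‖f w‖ ≤ M := by
  by_contra hcon
  push Not at hcon
  choose s hs w hw hsw using fun n : ℕ =>
    hcon (1 / (n + 1)) (by positivity : (0 : ℝ) < 1 / (n + 1)) n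
  obtain ⟨N, hNo, -, hzN, hNn⟩ := id hz
  rcases hNn s hs with ⟨φ, hφ, l, hl⟩ | ⟨φ, hφ, hl⟩
  · have hlc : ContinuousOn l N :=
      hl.continuousOn (Frequently.of_forall fun k => (hd _ (hs _)).continuous.continuousOn)
    have hwz : Tendsto w atTop (𝓝 z) := by
      rw [tendsto_iff_dist_tendsto_zero]
      exact squeeze_zero (fun _ => dist_nonneg) (fun n => (Metric.mem_ball.1 (hw n)).le)
        tendsto_one_div_add_atTop_nhds_zero_nat
    have hlim : Tendsto (fun k => s (φ k) (w (φ k))) atTop (𝓝 (l z)) := by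
      refine hl.tendsto_comp (hlc z hzN) hzN ?_
      rw [hNo.nhdsWithin_eq hzN]
      exact hwz.comp hφ.tendsto_atTop
    have htop : Tendsto (fun k => ‖s (φ k) (w (φ k))‖) atTop atTop :=
      tendsto_atTop_mono (fun k => (hsw (φ k)).le)
        (tendsto_natCast_atTop_atTop.comp hφ.tendsto_atTop)
    exact not_tendsto_nhds_of_tendsto_atTop htop _ hlim.norm
  · exact hinf s hs ⟨φ, hφ, tendstoInfty_connectedComponentIn (fun k => hs _)
      (mem_connectedComponentIn hz) (hl.tendstoInftyNear hNo hzN)⟩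

theorem exists_bound_of_isCompact {𝓕 : Set (ℂ → ℂ)} {K : Set ℂ} (hK : IsCompact K)
    (hloc : ∀ z ∈ K, ∃ r > 0, ∃ M : ℝ, ∀ f ∈ 𝓕, ∀ w ∈ Metric.ball z r, ‖f w‖ ≤ M) :
    ∃ M : ℝ, ∀ f ∈ 𝓕, ∀ w ∈ K, ‖f w‖ ≤ M := by
  refine hK.induction_on (p := fun t => ∃ M : ℝ, ∀ f ∈ 𝓕, ∀ w ∈ t, ‖f w‖ ≤ M) ⟨0, by simp⟩ ?_ ?_ ?_
  · rintro s t hst ⟨M, hM⟩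
    exact ⟨M, fun f hf w hw => hM f hf w (hst hw)⟩
  · rintro s t ⟨M, hM⟩ ⟨M', hM'⟩
    refine ⟨max M M', fun f hf w hw => ?_⟩
    rcases hw with hw | hw
    · exact (hM f hf w hw).trans (le_max_left _ _)
    · exact (hM' f hf w hw).trans (le_max_right _ _)
  · intro z hz
    obtain ⟨r, hr, h⟩ := hloc z hz
    exact ⟨Metric.ball z r, mem_nhdsWithin_of_mem_nhds (Metric.ball_mem_nhds z hr), h⟩

/-! ### Components of the set of normality -/

/-- For a locally bounded family of entire functions with bounded components of the set of
normality, the complement of a component has no compact part that is separated from the rest. By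
the maximum principle, the family would be bounded near such a part `A`, so that `A` would consist
of points of normality, and the component of a point of `A` would be both open and closed. -/
theorem not_compl_component_eq_union {𝓕 : Set (ℂ → ℂ)} (hd : ∀ f ∈ 𝓕, Differentiable ℂ f)
    (hb : ∀ z ∈ normalitySet 𝓕, Bornology.IsBounded (connectedComponentIn (normalitySet 𝓕) z))
    (hloc : ∀ z ∈ normalitySet 𝓕,
      ∃ r > 0, ∃ M : ℝ, ∀ f ∈ 𝓕, ∀ w ∈ Metric.ball z r, ‖f w‖ ≤ M)
    {z : ℂ} {A B : Set ℂ} (hA : IsCompact A) (hB : IsClosed B)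
    (hAB : A ∩ B = ∅) (hne : A.Nonempty)
    (hU : (connectedComponentIn (normalitySet 𝓕) z)ᶜ = A ∪ B) : False := by
  set F := normalitySet 𝓕 with hF
  have hFo : IsOpen F := isOpen_normalitySet 𝓕
  obtain ⟨ε, hε, hεB⟩ := hA.exists_cthickening_subset_open hB.isOpen_compl
    (fun x hx hx' => (hAB ▸ ⟨hx, hx'⟩ : x ∈ (∅ : Set ℂ)))
  set K := Metric.cthickening ε A \ Metric.thickening ε A with hKdef
  have hK : IsCompact K := (hA.cthickening (r := ε)).diff Metric.isOpen_thickening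
  have hKF : K ⊆ F := by
    intro x hx
    apply connectedComponentIn_subset F z
    by_contra hxU
    rcases (hU ▸ hxU : x ∈ A ∪ B) with h | h
    · exact hx.2 (Metric.self_subset_thickening hε _ h)
    · exact hεB hx.1 h
  obtain ⟨M, hM⟩ := exists_bound_of_isCompact hK fun x hx => hloc x (hKF hx)
  have hfr : frontier (Metric.thickening ε A) ⊆ K := by
    rw [Metric.isOpen_thickening.frontier_eq]
    exact sdiff_subset_sdiff_left (Metric.closure_thickening_subset_cthickening ε A)
  have hbound : ∀ f ∈ 𝓕, ∀ w ∈ Metric.thickening ε A, ‖f w‖ ≤ M := fun f hf w hw =>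
    Complex.norm_le_of_forall_mem_frontier_norm_le hA.isBounded.thickening (hd f hf).diffContOnCl
      (fun x hx => hM f hf x (hfr hx)) (subset_closure hw)
  have hAF : A ⊆ F := by
    intro a ha
    refine ⟨Metric.ball a (ε / 3), Metric.isOpen_ball,
      (convex_ball a _).isConnected (Metric.nonempty_ball.2 (by positivity)),
      Metric.mem_ball_self (by positivity), ?_⟩
    refine isNormalOn_ball_of_bounded hd (M := M) (by positivity) fun f hf w hw => hbound f hf w ?_
    refine Metric.ball_subset_thickening ha ε ?_
    rw [Metric.mem_closedBall] at hw
    rw [Metric.mem_ball]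
    linarith
  obtain ⟨a, ha⟩ := hne
  set W := connectedComponentIn F a with hW
  have haW : a ∈ W := mem_connectedComponentIn (hAF ha)
  have haU : a ∈ (connectedComponentIn F z)ᶜ := hU ▸ Or.inl ha
  have hWU : W ⊆ A ∪ B := by
    rw [← hU]
    intro x hx hxz
    apply haU
    rw [connectedComponentIn_eq hxz, ← connectedComponentIn_eq hx]
    exact haW
  have hWA : W ⊆ A := by
    intro x hx
    refine (hWU hx).resolve_right fun hxB => ?_
    obtain ⟨y, -, hy⟩ := isPreconnected_closed_iff.1 isPreconnected_connectedComponentIn A B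
      hA.isClosed hB hWU ⟨a, haW, ha⟩ ⟨x, hx, hxB⟩
    exact (hAB ▸ hy : y ∈ (∅ : Set ℂ))
  have hWfr : (frontier W).Nonempty := nonempty_frontier_iff.2 ⟨⟨a, haW⟩, fun h =>
    NormedSpace.unbounded_univ ℝ ℂ (h ▸ hb a (hAF ha))⟩
  obtain ⟨y, hy⟩ := hWfr
  exact PlaneDomain.frontier_connectedComponentIn_subset hFo a hy
    (hAF (closure_minimal hWA hA.isClosed (frontier_subset_closure hy)))

theorem isPreconnected_setOf_lt_norm {R : ℝ} (hR : 0 < R) : IsPreconnected {z : ℂ | R < ‖z‖} := by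
  have : {z : ℂ | R < ‖z‖} = Complex.exp '' {w | Real.log R < w.re} := by
    ext z
    simp only [mem_image, mem_ofPred_eq]
    constructor
    · intro hz
      have hz0 : z ≠ 0 := by
        rintro rfl
        rw [norm_zero] at hz
        exact lt_asymm hz hR
      exact ⟨Complex.log z, by rw [Complex.log_re]; exact Real.log_lt_log hR hz,
        Complex.exp_log hz0⟩
    · rintro ⟨w, hw, rfl⟩
      rw [Complex.norm_exp]
      exact (Real.log_lt_iff_lt_exp hR).1 hw
  rw [this]
  exact (convex_halfSpace_re_gt _).isPreconnected.image _ Complex.continuous_exp.continuousOn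

/-- For a locally bounded family of entire functions with bounded components of the set of
normality, these components have connected complements: of the two parts of a separation, one does
not meet the connected exterior of a large disc, and is therefore compact. -/
theorem isPreconnected_compl_component {𝓕 : Set (ℂ → ℂ)} (hd : ∀ f ∈ 𝓕, Differentiable ℂ f)
    (hb : ∀ z ∈ normalitySet 𝓕, Bornology.IsBounded (connectedComponentIn (normalitySet 𝓕) z))
    (hloc : ∀ z ∈ normalitySet 𝓕,
      ∃ r > 0, ∃ M : ℝ, ∀ f ∈ 𝓕, ∀ w ∈ Metric.ball z r, ‖f w‖ ≤ M)
    {z : ℂ} (hz : z ∈ normalitySet 𝓕) :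
    IsPreconnected (connectedComponentIn (normalitySet 𝓕) z)ᶜ := by
  set U := connectedComponentIn (normalitySet 𝓕) z with hU
  have hUc : IsClosed Uᶜ := (isOpen_normalitySet 𝓕).connectedComponentIn.isClosed_compl
  obtain ⟨R, hR, hUR⟩ := (hb z hz).exists_pos_norm_le
  have hext : {w : ℂ | R < ‖w‖} ⊆ Uᶜ := fun w hw hwU => (hUR w hwU).not_gt hw
  rw [isPreconnected_closed_iff]
  intro A B hA hB hAB hA' hB'
  by_contra hdis
  rw [not_nonempty_iff_eq_empty] at hdis
  have key : ∀ A B : Set ℂ, IsClosed A → IsClosed B → Uᶜ ⊆ A ∪ B → (Uᶜ ∩ A).Nonempty →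
      Uᶜ ∩ (A ∩ B) = ∅ → ({w : ℂ | R < ‖w‖} ∩ A) = ∅ → False := by
    intro A B hA hB hAB hA' hdis hE
    refine not_compl_component_eq_union (z := z) hd hb hloc (A := Uᶜ ∩ A) (B := Uᶜ ∩ B) ?_
      (hUc.inter hB) ?_ hA' ?_
    · refine Metric.isCompact_of_isClosed_isBounded (hUc.inter hA) ?_
      refine (Metric.isBounded_closedBall (x := (0 : ℂ)) (r := R)).subset fun x hx => ?_
      rw [mem_closedBall_zero_iff]
      by_contra hx'
      exact (hE ▸ ⟨not_le.1 hx', hx.2⟩ : x ∈ (∅ : Set ℂ))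
    · rw [← hdis]
      ext x
      simp only [mem_inter_iff]
      tauto
    · rw [← inter_union_distrib_left, inter_eq_left.2 hAB]
  by_cases h1 : ({w : ℂ | R < ‖w‖} ∩ A) = ∅
  · exact key A B hA hB hAB hA' hdis h1
  · by_cases h2 : ({w : ℂ | R < ‖w‖} ∩ B) = ∅
    · exact key B A hB hA (union_comm A B ▸ hAB) hB' (inter_comm A B ▸ hdis) h2
    · obtain ⟨x, hx1, hx2⟩ := isPreconnected_closed_iff.1 (isPreconnected_setOf_lt_norm hR) A B
        hA hB (hext.trans hAB) (nonempty_iff_ne_empty.2 h1) (nonempty_iff_ne_empty.2 h2)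
      exact (hdis ▸ ⟨hext hx1, hx2⟩ : x ∈ (∅ : Set ℂ))

/-! ### The generated semigroup -/

theorem differentiable_of_mem_generatedSemigroup {n : ℕ} {g : Fin n → ℂ → ℂ}
    (hg : ∀ i, Differentiable ℂ (g i)) {f : ℂ → ℂ}
    (hf : (f : Function.End ℂ) ∈ generatedSemigroup g) : Differentiable ℂ f := by
  induction hf using Subsemigroup.closure_induction with
  | mem f hf =>
    obtain ⟨i, rfl⟩ := hf
    exact hg i
  | mul f h _ _ hf hh => exact Differentiable.comp (g := f) (f := h) hf hh

theorem iterate_mem_generatedSemigroup {n : ℕ} (g : Fin n → ℂ → ℂ) (i : Fin n) (m : ℕ) :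
    ((g i)^[m + 1] : Function.End ℂ) ∈ generatedSemigroup g := by
  have hi : (g i : Function.End ℂ) ∈ generatedSemigroup g :=
    Subsemigroup.subset_closure ⟨i, rfl⟩
  induction m with
  | zero => exact hi
  | succ m ih =>
    have h := (generatedSemigroup g).mul_mem ih hi
    exact h

theorem semigroupFatouSet_subset_fatouSet {n : ℕ} (g : Fin n → ℂ → ℂ) (i : Fin n) :
    semigroupFatouSet (generatedSemigroup g) ⊆ fatouSet (g i) := by
  refine normalitySet_anti ?_
  rintro h ⟨m, hm, rfl⟩
  obtain ⟨k, rfl⟩ := Nat.exists_eq_succ_of_ne_zero (Nat.one_le_iff_ne_zero.1 hm)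
  exact iterate_mem_generatedSemigroup g i k

end TranscendentalSemigroup

theorem theorem2p4 (n : ℕ) (hn : 1 ≤ n) (g : Fin n → ℂ → ℂ)
    (hg : ∀ i, TranscendentalSemigroup.IsTranscendentalEntire (g i))
    (hab : ∀ i j, g i ∘ g j = g j ∘ g i)
    (hbdd : ∀ i, ∀ U : Set ℂ,
      TranscendentalSemigroup.IsComponentOf U (TranscendentalSemigroup.fatouSet (g i)) →
        Bornology.IsBounded U)
    (hinf : ∀ U : Set ℂ,
      TranscendentalSemigroup.IsComponentOf U
        (TranscendentalSemigroup.semigroupFatouSet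
          (TranscendentalSemigroup.generatedSemigroup g)) →
      ∀ s : ℕ → ℂ → ℂ,
        (∀ k, (s k : Function.End ℂ) ∈ TranscendentalSemigroup.generatedSemigroup g) →
        ¬ TranscendentalSemigroup.InftyIsLimitFunction s U) :
    (∀ U : Set ℂ,
      TranscendentalSemigroup.IsComponentOf U
        (TranscendentalSemigroup.semigroupFatouSet
          (TranscendentalSemigroup.generatedSemigroup g)) →
      IsSimplyConnected U) ∧
    IsConnected
      (TranscendentalSemigroup.semigroupJuliaSet
        (TranscendentalSemigroup.generatedSemigroup g)) := by
  open TranscendentalSemigroup in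
  have hd : ∀ f ∈ {h : ℂ → ℂ | (h : Function.End ℂ) ∈ generatedSemigroup g},
      Differentiable ℂ f :=
    fun f hf => differentiable_of_mem_generatedSemigroup (fun i => (hg i).1) hf
  have hb : ∀ z ∈ semigroupFatouSet (generatedSemigroup g), Bornology.IsBounded
      (connectedComponentIn (semigroupFatouSet (generatedSemigroup g)) z) := by
    intro z hz
    have hsub := semigroupFatouSet_subset_fatouSet g ⟨0, hn⟩
    exact (hbdd ⟨0, hn⟩ _ ⟨z, hsub hz, rfl⟩).subset (connectedComponentIn_mono z hsub)
  have hcompl : ∀ z ∈ semigroupFatouSet (generatedSemigroup g), IsPreconnected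
      (connectedComponentIn (semigroupFatouSet (generatedSemigroup g)) z)ᶜ := fun z hz =>
    isPreconnected_compl_component hd hb
      (fun w hw => exists_ball_bounded hd hw (hinf _ ⟨w, hw, rfl⟩)) hz
  have hopen : IsOpen (semigroupFatouSet (generatedSemigroup g)) := isOpen_normalitySet _
  refine ⟨?_, PlaneDomain.isConnected_compl_of_components hopen hb hcompl⟩
  rintro U ⟨z, hz, rfl⟩
  exact PlaneDomain.isSimplyConnected_of_isPreconnected_compl hopen.connectedComponentIn
    (isConnected_connectedComponentIn_iff.2 hz) (hb z hz) (hcompl z hz)
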